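/- Let $O$ be a discrete valuation ring with uniformizer $\pi$. Let $m\ge 1$, let indices $i$ be taken in $\mathbb{Z}/m$, and let $\Lambda_i=O^n$ with standard basis $e^i_1,\dots,e^i_n$. Let $\phi_i:\Lambda_i\to\Lambda_{i+1}$ ($i\in\mathbb{Z}/m$) be given by diagonal matrices whose diagonal entries are all $1$ or $\pi$, with $\phi_{m-1}\cdots\phi_0=\pi$. Let $M=M(m,n,r,(\phi_i)_i)$ be the corresponding generalized local model: for an $O$-scheme $S$, $M(S)$ is the set of tuples $(\mathcal{F}_i)_i$ of $\mathcal{O}_S$-submodules $\mathcal{F}_i\subseteq\Lambda_{i,S}=\Lambda_i\otimes_O\mathcal{O}_S$ that are locally free of rank $r$, Zariski-locally on $S$ direct summands, and satisfy $\phi_i(\mathcal{F}_i)\subseteq\mathcal{F}_{i+1}$ for all $i$. Let $t_i\in\{0,1\}^n$ ($i\in\mathbb{Z}/m$) be vectors with exactly $r$ entries equal to $1$ such that (i) for every $j$ the sequence $(t_0(j),\dots,t_{m-1}(j))$ is a cyclic permutation of $(1^{\kappa},0^{m-\kappa})$ for some $\kappa$, and (ii) if $t_i(j)=1$ and $t_{i+1}(j)=0$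 then $\phi_i(e^i_j)=\pi e^{i+1}_j$. Let $U=U((t_i)_i)\subseteq M$ be the open locus, given on $S$-valued points by the condition that for every $i$ the sheaf $\Lambda_{i,S}/\mathcal{F}_i$ is generated by the $e^i_j$ with $t_i(j)=0$. Put $$\mathcal{S}=\{j:\ t_i(j)=0\text{ for all }i\},\qquad \mathcal{T}=\{j:\ t_i(j)=1\text{ for all }i\},\qquad s=\#\mathcal{S},\quad t=\#\mathcal{T},\quad N=n-r-s.$$ For each $i$ let $j^i_1,\dots,j^i_N$ be any enumeration of the set $\{j\notin\mathcal{S}:\ t_i(j)=0\}$, which has $N$ elements. Let $\mathfrak{X}_i$ be the affine subspace of the space $\mathrm{Mat}_N$ of $N\times N$-matrices over $O$ consisting of those $X=(x_{\mu,\nu})$ such that, for every $\iota$ with $t_{i+1}(j^i_\iota)=0$ (so $j^i_\iota=j^{i+1}_{\iota'}$ for a unique $\iota'$), the $\iota$-th column of $X$ is given by $$x_{\mu,\iota}=\pi^{\varepsilon}\,\delta_{\mu,\iota'}\quad(\mu=1,\dots,N),\qquad\text{where } \phi_i(e^i_{j})=\pi^{\varepsilon}e^{i+1}_{j},\ j=j^i_\iota,\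 \varepsilon\in\{0,1\}.$$ Let $W$ be the closed subscheme of $\prod_{i=0}^{m-1}\mathfrak{X}_i$ of all tuples $(X_i)_i$ all of whose cyclic products are equal to $\pi$: $$X_{m-1}X_{m-2}\cdots X_0=X_{m-2}\cdots X_0X_{m-1}=\cdots=X_0X_{m-1}\cdots X_1=\pi .$$ Then there is an isomorphism of $O$-schemes $$U\;\cong\;W\times_O\mathbb{A}^{\,rs+t(n-r-s)}_O,$$ that is, $W\times_O\mathbb{A}^{rs+t(n-r-s)}_O$ represents the functor of points of $U$ on $O$-schemes. -/

import Mathlib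

open CategoryTheory AlgebraicGeometry Opposite
open scoped Matrix

universe u

noncomputable section

namespace LocalModel

/-! ### Subsheaves of modules of the free sheaf `𝒪_S ^ n` -/

/-- Restriction of functions from an open set `V` to a smaller open set `V'`. -/
def res {S : Scheme.{u}} {V' V : S.Opens} (h : V' ≤ V) : Γ(S, V) →+* Γ(S, V') :=
  (S.presheaf.map (homOfLE h).op).hom

/-- Pull-back of functions along a morphism `f`, from an open set `U` of the target
to an open set `V` of the source which is mapped into `U`. -/
def pull {X Y : Scheme.{u}} (f : X ⟶ Y) {U : Y.Opens} {V : X.Opens} (h : V ≤ f ⁻¹ᵁ U) :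
    Γ(Y, U) →+* Γ(X, V) :=
  (f.appLE U V h).hom

/-- A subsheaf of `𝒪_S`-modules of the free sheaf `𝒪_S ^ n`. -/
@[ext]
structure Subsheaf (S : Scheme.{u}) (n : ℕ) where
  /-- The sections over an open set. -/
  sec : ∀ V : S.Opens, Submodule Γ(S, V) (Fin n → Γ(S, V))
  res_mem : ∀ {V' V : S.Opens} (h : V' ≤ V) (v : Fin n → Γ(S, V)),
    v ∈ sec V → res h ∘ v ∈ sec V'
  mem_of_local : ∀ (V : S.Opens) (v : Fin n → Γ(S, V)),
    (∀ x ∈ V, ∃ (V' : S.Opens) (h : V' ≤ V), x ∈ V' ∧ res h ∘ v ∈ sec V') → v ∈ sec V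

/-- The subsheaf of `𝒪_S`-modules of `𝒪_S ^ n` generated by a family `E` of local sections:
the smallest one that contains them. -/
def generate {S : Scheme.{u}} {n : ℕ} (E : ∀ V : S.Opens, Set (Fin n → Γ(S, V))) :
    Subsheaf S n where
  sec V := ⨅ G : {G : Subsheaf S n // ∀ V', E V' ⊆ G.sec V'}, G.1.sec V
  res_mem h v hv := by
    simp only [Submodule.mem_iInf] at hv ⊢
    exact fun G => G.1.res_mem h v (hv G)
  mem_of_local V v hv := by
    simp only [Submodule.mem_iInf] at hv ⊢
    refine fun G => G.1.mem_of_local V v fun x hx => ?_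
    obtain ⟨V', h, hx', hm⟩ := hv x hx
    exact ⟨V', h, hx', hm G⟩

theorem subset_generate {S : Scheme.{u}} {n : ℕ} (E : ∀ V : S.Opens, Set (Fin n → Γ(S, V)))
    (V : S.Opens) : E V ⊆ (generate E).sec V := by
  intro v hv
  simp only [generate, SetLike.mem_coe, Submodule.mem_iInf]
  exact fun G => G.2 V hv

theorem generate_le {S : Scheme.{u}} {n : ℕ} {E : ∀ V : S.Opens, Set (Fin n → Γ(S, V))}
    (G : Subsheaf S n) (h : ∀ V, E V ⊆ G.sec V) (V : S.Opens) :
    (generate E).sec V ≤ G.sec V :=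
  iInf_le (fun G : {G : Subsheaf S n // ∀ V', E V' ⊆ G.sec V'} => G.1.sec V) ⟨G, h⟩

/-- The pull-back of a subsheaf `F ⊆ 𝒪_Y ^ n` along `f : X ⟶ Y`: the `𝒪_X`-submodule of
`𝒪_X ^ n = f^* 𝒪_Y ^ n` generated by the pull-backs of the sections of `F`,
that is, the image of `f^* F` in `f^* 𝒪_Y ^ n`. (If `F` is locally a direct summand,
`f^* F` maps isomorphically onto this image.) -/
def Subsheaf.pullback {X Y : Scheme.{u}} {n : ℕ} (f : X ⟶ Y) (F : Subsheaf Y n) :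
    Subsheaf X n :=
  generate fun V =>
    {v | ∃ (U : Y.Opens) (h : V ≤ f ⁻¹ᵁ U), ∃ w ∈ F.sec U, v = pull f h ∘ w}

/-- `F` is locally free of rank `r`: every point has an open neighbourhood `V` with `r` sections
of `F` over `V` that give an isomorphism of `𝒪_V ^ r` with `F` over `V`. -/
def Subsheaf.IsLocallyFree {S : Scheme.{u}} {n : ℕ} (F : Subsheaf S n) (r : ℕ) : Prop :=
  ∀ x : S, ∃ V : S.Opens, x ∈ V ∧ ∃ b : Fin r → (Fin n → Γ(S, V)),
    ∀ (V' : S.Opens) (h : V' ≤ V),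
      LinearIndependent Γ(S, V') (fun k => (res h ∘ b k : Fin n → Γ(S, V'))) ∧
      Submodule.span Γ(S, V') (Set.range fun k => (res h ∘ b k : Fin n → Γ(S, V'))) = F.sec V'

/-- `F` is Zariski-locally on `S` a direct summand of `𝒪_S ^ n`.
(A complement over the open set `V` can be extended to a subsheaf `G` on the whole of `S`, by
taking those local sections whose restriction to `V` lies in the complement.) -/
def Subsheaf.IsLocallyDirectSummand {S : Scheme.{u}} {n : ℕ} (F : Subsheaf S n) : Prop :=
  ∀ x : S, ∃ V : S.Opens, x ∈ V ∧ ∃ G : Subsheaf S n,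
    ∀ V' : S.Opens, V' ≤ V → IsCompl (F.sec V') (G.sec V')

/-- The quotient `𝒪_S ^ n / F` is generated, as a sheaf of modules, by the classes of the standard
basis vectors `e_j`, `j ∈ J`. -/
def Subsheaf.QuotientGeneratedBy {S : Scheme.{u}} {n : ℕ} (F : Subsheaf S n)
    (J : Set (Fin n)) : Prop :=
  ∀ V : S.Opens,
    (generate fun V : S.Opens =>
      (F.sec V : Set (Fin n → Γ(S, V))) ∪ {v | ∃ j ∈ J, v = Pi.single j 1}).sec V = ⊤

/-! ### Elementary facts that are needed for functoriality -/

theorem res_res {S : Scheme.{u}} {V'' V' V : S.Opens} (h : V'' ≤ V') (h' : V' ≤ V)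
    (a : Γ(S, V)) : res h (res h' a) = res (h.trans h') a := by
  simp only [res, ← CommRingCat.comp_apply, ← Functor.map_comp]
  rfl

theorem res_pull {X Y : Scheme.{u}} (f : X ⟶ Y) {U : Y.Opens} {V' V : X.Opens} (h' : V' ≤ V)
    (h : V ≤ f ⁻¹ᵁ U) (a : Γ(Y, U)) : res h' (pull f h a) = pull f (h'.trans h) a := by
  simp only [res, pull, ← CommRingCat.comp_apply, Scheme.Hom.appLE_map]

theorem pull_res {X Y : Scheme.{u}} (f : X ⟶ Y) {U' U : Y.Opens} {V : X.Opens} (h' : U' ≤ U)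
    (h : V ≤ f ⁻¹ᵁ U') (a : Γ(Y, U)) :
    pull f h (res h' a) = pull f (h.trans (f.preimage_mono h')) a := by
  simp only [res, pull, ← CommRingCat.comp_apply, Scheme.Hom.map_appLE]

theorem pull_pull {X Y Z : Scheme.{u}} (f : X ⟶ Y) (g : Y ⟶ Z) {U : Z.Opens} {V : Y.Opens}
    {W : X.Opens} (h : W ≤ f ⁻¹ᵁ V) (h' : V ≤ g ⁻¹ᵁ U) (h'' : W ≤ (f ≫ g) ⁻¹ᵁ U) (a : Γ(Z, U)) :
    pull f h (pull g h' a) = pull (f ≫ g) h'' a := by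
  simp only [pull, ← CommRingCat.comp_apply, Scheme.Hom.appLE_comp_appLE]

theorem pull_id {X : Scheme.{u}} {V U : X.Opens} (h : V ≤ (𝟙 X : X ⟶ X) ⁻¹ᵁ U) (h' : V ≤ U)
    (a : Γ(X, U)) : pull (𝟙 X) h a = res h' a := by
  simp only [pull, res, Scheme.Hom.appLE, Scheme.Hom.id_app]
  rfl

theorem pull_mem_pullback {X Y : Scheme.{u}} {n : ℕ} (f : X ⟶ Y) (F : Subsheaf Y n)
    {U : Y.Opens} {V : X.Opens} (h : V ≤ f ⁻¹ᵁ U) {w : Fin n → Γ(Y, U)} (hw : w ∈ F.sec U) :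
    pull f h ∘ w ∈ (F.pullback f).sec V :=
  subset_generate _ V ⟨U, h, w, hw, rfl⟩

theorem pullback_le {X Y : Scheme.{u}} {n : ℕ} (f : X ⟶ Y) (F : Subsheaf Y n) (G : Subsheaf X n)
    (hG : ∀ (U : Y.Opens) (V : X.Opens) (h : V ≤ f ⁻¹ᵁ U), ∀ w ∈ F.sec U,
      pull f h ∘ w ∈ G.sec V) (V : X.Opens) :
    (F.pullback f).sec V ≤ G.sec V := by
  refine generate_le G ?_ V
  rintro V v ⟨U, h, w, hw, rfl⟩
  exact hG U V h w hw

/-- The subsheaf of those local sections of `𝒪_Y ^ n` whose pull-backs lie in `G`. -/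
def pushSub {X Y : Scheme.{u}} {n : ℕ} (f : X ⟶ Y) (G : Subsheaf X n) : Subsheaf Y n where
  sec U := (G.sec (f ⁻¹ᵁ U)).comap (σ₁₂ := pull f le_rfl)
    { toFun := fun w => pull f le_rfl ∘ w
      map_add' := fun a b => by ext; simp
      map_smul' := fun a b => by ext; simp }
  res_mem {V' V} h v hv := by
    simp only [Submodule.mem_comap, LinearMap.coe_mk, AddHom.coe_mk] at hv ⊢
    have := G.res_mem (f.preimage_mono h) _ hv
    convert this using 1
    ext j
    simp only [Function.comp_apply, res_pull, pull_res]
  mem_of_local V v hv := by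
    simp only [Submodule.mem_comap, LinearMap.coe_mk, AddHom.coe_mk] at hv ⊢
    refine G.mem_of_local _ _ fun x hx => ?_
    obtain ⟨V', h, hx', hm⟩ := hv (f x) hx
    refine ⟨f ⁻¹ᵁ V', f.preimage_mono h, hx', ?_⟩
    convert hm using 1
    ext j
    simp only [Function.comp_apply, res_pull, pull_res]

theorem mem_pushSub {X Y : Scheme.{u}} {n : ℕ} (f : X ⟶ Y) (G : Subsheaf X n) {U : Y.Opens}
    (w : Fin n → Γ(Y, U)) :
    w ∈ (pushSub f G).sec U ↔ pull f (le_refl (f ⁻¹ᵁ U)) ∘ w ∈ G.sec (f ⁻¹ᵁ U) := Iff.rfl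

theorem pullback_id {X : Scheme.{u}} {n : ℕ} (F : Subsheaf X n) : F.pullback (𝟙 X) = F := by
  ext1
  funext V
  apply le_antisymm
  · refine pullback_le _ _ _ (fun U V h w hw => ?_) V
    have h' : V ≤ U := h
    have := F.res_mem h' w hw
    convert this using 1
    ext j
    exact pull_id h h' _
  · intro v hv
    have h : V ≤ (𝟙 X : X ⟶ X) ⁻¹ᵁ V := le_refl V
    have := pull_mem_pullback (𝟙 X) F h hv
    convert this using 1
    ext j
    simp only [Function.comp_apply]
    rw [pull_id h le_rfl]
    simp [res]

theorem pullback_comp {X Y Z : Scheme.{u}} {n : ℕ} (f : X ⟶ Y) (g : Y ⟶ Z) (F : Subsheaf Z n) :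
    F.pullback (f ≫ g) = (F.pullback g).pullback f := by
  ext1
  funext V
  apply le_antisymm
  · refine pullback_le _ _ _ (fun U V h w hw => ?_) V
    have h' : V ≤ f ⁻¹ᵁ (g ⁻¹ᵁ U) := h
    have := pull_mem_pullback f _ h' (pull_mem_pullback g F (le_refl (g ⁻¹ᵁ U)) hw)
    convert this using 1
    ext j
    exact (pull_pull f g _ _ _ _).symm
  · refine pullback_le _ _ _ (fun U V h w hw => ?_) V
    have key : ∀ U, (F.pullback g).sec U ≤ (pushSub f (F.pullback (f ≫ g))).sec U := by
      refine pullback_le _ _ _ (fun U V h w hw => ?_)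
      rw [mem_pushSub]
      have h' : f ⁻¹ᵁ V ≤ (f ≫ g) ⁻¹ᵁ U := f.preimage_mono h
      have := pull_mem_pullback (f ≫ g) F h' hw
      convert this using 1
      ext j
      exact pull_pull f g _ _ _ _
    have h2 := (F.pullback (f ≫ g)).res_mem h _ ((mem_pushSub f _ _).1 (key U hw))
    convert h2 using 1
    ext j
    simp only [Function.comp_apply, res_pull]


theorem comp_mulVec {R R' : Type*} [CommRing R] [CommRing R'] {p q : ℕ} (ρ : R →+* R')
    (A : Matrix (Fin p) (Fin q) R) (v : Fin q → R) : ρ ∘ (A *ᵥ v) = A.map ρ *ᵥ (ρ ∘ v) :=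
  funext fun i => RingHom.map_mulVec ρ A v i

theorem comp_single {R R' : Type*} [CommRing R] [CommRing R'] {n : ℕ} (ρ : R →+* R')
    (j : Fin n) : ρ ∘ (Pi.single j 1 : Fin n → R) = Pi.single j 1 := by
  ext i
  by_cases hij : i = j
  · subst hij; simp
  · simp [Pi.single_eq_of_ne hij]

theorem res_comp_res {S : Scheme.{u}} {n : ℕ} {V'' V' V : S.Opens} (h : V'' ≤ V') (h' : V' ≤ V)
    (v : Fin n → Γ(S, V)) : res h ∘ (res h' ∘ v) = res (h.trans h') ∘ v :=
  funext fun _ => res_res _ _ _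

theorem res_self {S : Scheme.{u}} {n : ℕ} {V : S.Opens} (h : V ≤ V) (v : Fin n → Γ(S, V)) :
    res h ∘ v = v := by
  ext j
  simp [res]

theorem res_eq_zero_of_local {S : Scheme.{u}} {n : ℕ} {V : S.Opens} (v : Fin n → Γ(S, V))
    (h : ∀ x ∈ V, ∃ (V' : S.Opens) (h : V' ≤ V), x ∈ V' ∧ res h ∘ v = 0) : v = 0 := by
  choose W hW hxW hres using h
  funext j
  refine TopCat.Sheaf.eq_of_locally_eq' S.sheaf (fun x : V => W x.1 x.2) V
    (fun x => homOfLE (hW x.1 x.2)) ?_ _ _ ?_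
  · intro x hx
    exact TopologicalSpace.Opens.mem_iSup.2 ⟨⟨x, hx⟩, hxW x hx⟩
  · intro x
    have := congrFun (hres x.1 x.2) j
    refine Eq.trans this (Eq.symm ?_)
    exact map_zero (res (hW x.1 x.2))

/-- The subsheaf of those local sections that over `V` are annihilated by the matrix `Q`. -/
def kerSub {S : Scheme.{u}} {n p : ℕ} (V : S.Opens) (Q : Matrix (Fin p) (Fin n) Γ(S, V)) :
    Subsheaf S n where
  sec U :=
    { carrier := {v | ∀ (W : S.Opens) (h : W ≤ U) (h' : W ≤ V), Q.map (res h') *ᵥ (res h ∘ v) = 0}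
      zero_mem' := fun W h h' => by
        have : (res h ∘ (0 : Fin n → Γ(S, U))) = 0 := by ext; simp
        rw [this, Matrix.mulVec_zero]
      add_mem' := fun {a b} ha hb W h h' => by
        have : (res h ∘ (a + b)) = res h ∘ a + res h ∘ b := by ext; simp
        rw [this, Matrix.mulVec_add, ha W h h', hb W h h', add_zero]
      smul_mem' := fun c a ha W h h' => by
        have : (res h ∘ (c • a)) = res h c • (res h ∘ a) := by ext; simp
        rw [this, Matrix.mulVec_smul, ha W h h', smul_zero] }
  res_mem h v hv W hW hW' := by
    rw [res_comp_res]
    exact hv W _ hW'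
  mem_of_local U v hv W h h' := by
    refine res_eq_zero_of_local _ fun x hx => ?_
    obtain ⟨V', hV', hxV', hm⟩ := hv x (h hx)
    refine ⟨W ⊓ V', inf_le_left, ⟨hx, hxV'⟩, ?_⟩
    have := hm (W ⊓ V') inf_le_right (inf_le_left.trans h')
    rw [res_comp_res] at this
    rw [comp_mulVec, res_comp_res, ← this]
    congr 1
    ext i j
    simp only [Matrix.map_apply, res_res]

theorem mem_kerSub {S : Scheme.{u}} {n p : ℕ} {V : S.Opens} {Q : Matrix (Fin p) (Fin n) Γ(S, V)}
    {U : S.Opens} {v : Fin n → Γ(S, U)} : v ∈ (kerSub V Q).sec U ↔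
      ∀ (W : S.Opens) (h : W ≤ U) (h' : W ≤ V), Q.map (res h') *ᵥ (res h ∘ v) = 0 := Iff.rfl

theorem mem_kerSub_of_le {S : Scheme.{u}} {n p : ℕ} {V : S.Opens}
    {Q : Matrix (Fin p) (Fin n) Γ(S, V)} {U : S.Opens} (hU : U ≤ V) {v : Fin n → Γ(S, U)} :
    v ∈ (kerSub V Q).sec U ↔ Q.map (res hU) *ᵥ v = 0 := by
  rw [mem_kerSub]
  constructor
  · intro h
    have := h U le_rfl hU
    rwa [res_self] at this
  · intro h W hW hW'
    have h2 : Q.map (res hW') = (Q.map (res hU)).map (res hW) := by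
      ext i j
      simp only [Matrix.map_apply, res_res]
    rw [h2, ← comp_mulVec, h]
    ext; simp

theorem exists_split {S : Scheme.{u}} {n r : ℕ} {F : Subsheaf S n} (hF : F.IsLocallyFree r)
    (hF' : F.IsLocallyDirectSummand) (x : S) : ∃ V : S.Opens, x ∈ V ∧
      ∃ (B : Matrix (Fin n) (Fin r) Γ(S, V)) (C : Matrix (Fin r) (Fin n) Γ(S, V)), C * B = 1 ∧
        ∀ (V' : S.Opens) (h : V' ≤ V) (v : Fin n → Γ(S, V')),
          v ∈ F.sec V' ↔ (B * C).map (res h) *ᵥ v = v := by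
  obtain ⟨V₁, hx₁, b, hb⟩ := hF x
  obtain ⟨V₂, hx₂, G, hG⟩ := hF' x
  set V := V₁ ⊓ V₂ with hV
  have h₁ : V ≤ V₁ := inf_le_left
  have h₂ : V ≤ V₂ := inf_le_right
  obtain ⟨hli, hsp⟩ := hb V h₁
  have hdec : ∀ j : Fin n, ∃ c : Fin r → Γ(S, V),
      ((Pi.single j 1 : Fin n → Γ(S, V)) - ∑ k, c k • (res h₁ ∘ b k : Fin n → Γ(S, V))) ∈
        G.sec V := by
    intro j
    have : (Pi.single j 1 : Fin n → Γ(S, V)) ∈ F.sec V ⊔ G.sec V := by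
      rw [(hG V h₂).sup_eq_top]; trivial
    obtain ⟨p, hp, q, hq, hpq⟩ := Submodule.mem_sup.1 this
    rw [← hsp] at hp
    obtain ⟨c, hc⟩ := (Submodule.mem_span_range_iff_exists_fun _).1 hp
    refine ⟨c, ?_⟩
    rw [hc, ← hpq, add_sub_cancel_left]
    exact hq
  choose c hc using hdec
  let B : Matrix (Fin n) (Fin r) Γ(S, V) := Matrix.of fun i k => res h₁ (b k i)
  let C : Matrix (Fin r) (Fin n) Γ(S, V) := Matrix.of fun k j => c j k
  have hBmem : ∀ (V' : S.Opens) (h : V' ≤ V) (a : Fin r → Γ(S, V')),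
      B.map (res h) *ᵥ a ∈ F.sec V' := by
    intro V' h a
    rw [← (hb V' (h.trans h₁)).2]
    refine (Submodule.mem_span_range_iff_exists_fun _).2 ⟨a, ?_⟩
    ext i
    simp only [Finset.sum_apply, Pi.smul_apply, smul_eq_mul, Function.comp_apply, Matrix.mulVec,
      dotProduct, Matrix.map_apply, B, Matrix.of_apply, res_res]
    exact Finset.sum_congr rfl fun _ _ => mul_comm _ _
  have hmap : ∀ (V' : S.Opens) (h : V' ≤ V),
      (B * C).map (res h) = B.map (res h) * C.map (res h) := fun V' h => Matrix.map_mul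
  have hGmem : ∀ (V' : S.Opens) (h : V' ≤ V) (v : Fin n → Γ(S, V')),
      v - (B * C).map (res h) *ᵥ v ∈ G.sec V' := by
    intro V' h v
    have : v - (B * C).map (res h) *ᵥ v = ∑ j, v j • (res h ∘
        ((Pi.single j 1 : Fin n → Γ(S, V)) - ∑ k, c j k • (res h₁ ∘ b k : Fin n → Γ(S, V)))) := by
      ext i
      simp only [Pi.sub_apply, Finset.sum_apply, Pi.smul_apply, smul_eq_mul, Function.comp_apply,
        Matrix.mulVec, dotProduct, Matrix.map_apply, Matrix.mul_apply, B, C, Matrix.of_apply,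
        map_sub, map_sum, map_mul, mul_sub, Finset.sum_sub_distrib]
      congr 1
      · rw [Finset.sum_eq_single i]
        · simp
        · intro j _ hj
          simp [Pi.single_eq_of_ne hj.symm]
        · simp
      · refine Finset.sum_congr rfl fun j _ => ?_
        rw [mul_comm]
        congr 1
        exact Finset.sum_congr rfl fun k _ => mul_comm _ _
    rw [this]
    exact Submodule.sum_mem _ fun j _ => Submodule.smul_mem _ _ (G.res_mem h _ (hc j))
  have hchar : ∀ (V' : S.Opens) (h : V' ≤ V) (v : Fin n → Γ(S, V')),
      v ∈ F.sec V' ↔ (B * C).map (res h) *ᵥ v = v := by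
    intro V' h v
    have hmem : (B * C).map (res h) *ᵥ v ∈ F.sec V' := by
      rw [hmap, ← Matrix.mulVec_mulVec]
      exact hBmem V' h _
    constructor
    · intro hv
      have h0 := (Submodule.disjoint_def.1 (hG V' (h.trans h₂)).disjoint) _
        (Submodule.sub_mem _ hv hmem) (hGmem V' h v)
      exact (sub_eq_zero.1 h0).symm
    · intro hv
      rwa [hv] at hmem
  refine ⟨V, ⟨hx₁, hx₂⟩, B, C, ?_, hchar⟩
  have hinj : Function.Injective B.mulVec := by
    rw [Matrix.mulVec_injective_iff]
    exact hli
  have hid : (res (le_refl V) : Γ(S, V) → Γ(S, V)) = id := by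
    ext a; simp [res]
  have hBCB : B * (C * B) = B * (1 : Matrix (Fin r) (Fin r) Γ(S, V)) := by
    ext i k
    have h1 := (hchar V le_rfl (B *ᵥ Pi.single k 1)).1 (by
      have := hBmem V le_rfl (Pi.single k 1)
      rwa [hid, Matrix.map_id] at this)
    rw [hid, Matrix.map_id, Matrix.mulVec_mulVec] at h1
    have := congrFun h1 i
    rw [Matrix.mul_one]
    simpa [Matrix.mul_assoc] using this
  ext i k
  have : B *ᵥ ((C * B) *ᵥ Pi.single k 1) = B *ᵥ ((1 : Matrix (Fin r) (Fin r) _) *ᵥ Pi.single k 1) := by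
    rw [Matrix.mulVec_mulVec, hBCB, Matrix.mulVec_mulVec]
  simpa using congrFun (hinj this) i

theorem of_split {S : Scheme.{u}} {n r : ℕ} {F : Subsheaf S n}
    (H : ∀ x : S, ∃ V : S.Opens, x ∈ V ∧
      ∃ (B : Matrix (Fin n) (Fin r) Γ(S, V)) (C : Matrix (Fin r) (Fin n) Γ(S, V)), C * B = 1 ∧
        ∀ (V' : S.Opens) (h : V' ≤ V) (v : Fin n → Γ(S, V')),
          v ∈ F.sec V' ↔ (B * C).map (res h) *ᵥ v = v) :
    F.IsLocallyFree r ∧ F.IsLocallyDirectSummand := by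
  refine ⟨fun x => ?_, fun x => ?_⟩
  · obtain ⟨V, hx, B, C, hCB, hF⟩ := H x
    refine ⟨V, hx, fun k i => B i k, fun V' h => ?_⟩
    have hCB' : C.map (res h) * B.map (res h) = 1 := by
      rw [← Matrix.map_mul, hCB, Matrix.map_one _ (map_zero _) (map_one _)]
    have hcol : (fun k => (res h ∘ fun i => B i k : Fin n → Γ(S, V'))) = (B.map (res h)).col := rfl
    rw [hcol]
    constructor
    · rw [← Matrix.mulVec_injective_iff]
      exact Function.LeftInverse.injective (g := (C.map (res h)).mulVec) fun a => by
        rw [Matrix.mulVec_mulVec, hCB', Matrix.one_mulVec]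
    · rw [← Matrix.range_mulVecLin]
      ext v
      rw [hF V' h, Matrix.map_mul, ← Matrix.mulVec_mulVec]
      constructor
      · rintro ⟨a, rfl⟩
        rw [Matrix.mulVecLin_apply, Matrix.mulVec_mulVec _ (C.map (res h)), hCB',
          Matrix.one_mulVec]
      · intro hv
        exact ⟨_, hv⟩
  · obtain ⟨V, hx, B, C, hCB, hF⟩ := H x
    refine ⟨V, hx, kerSub V (B * C), fun V' h => ?_⟩
    have hPP : (B * C).map (res h) * (B * C).map (res h) = (B * C).map (res h) := by
      rw [← Matrix.map_mul, Matrix.mul_assoc, ← Matrix.mul_assoc C, hCB, Matrix.one_mul]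
    constructor
    · rw [Submodule.disjoint_def]
      intro v hv hv'
      rw [← (hF V' h v).1 hv]
      exact (mem_kerSub_of_le h).1 hv'
    · rw [codisjoint_iff, eq_top_iff]
      intro v _
      refine Submodule.mem_sup.2 ⟨(B * C).map (res h) *ᵥ v, ?_, v - (B * C).map (res h) *ᵥ v, ?_,
        add_sub_cancel _ _⟩
      · rw [hF V' h, Matrix.mulVec_mulVec, hPP]
      · rw [mem_kerSub_of_le h, Matrix.mulVec_sub, Matrix.mulVec_mulVec, hPP, sub_self]

theorem pullback_isLocallyFree {X Y : Scheme.{u}} {n r : ℕ} (f : X ⟶ Y) {F : Subsheaf Y n}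
    (hF : F.IsLocallyFree r ∧ F.IsLocallyDirectSummand) :
    (F.pullback f).IsLocallyFree r ∧ (F.pullback f).IsLocallyDirectSummand := by
  refine of_split fun x => ?_
  obtain ⟨V, hx, B, C, hCB, hchar⟩ := exists_split hF.1 hF.2 (f x)
  refine ⟨f ⁻¹ᵁ V, hx, B.map (pull f le_rfl), C.map (pull f le_rfl), ?_, ?_⟩
  · rw [← Matrix.map_mul, hCB, Matrix.map_one _ (map_zero _) (map_one _)]
  intro V' h v
  rw [← Matrix.map_mul]
  have hrp : ∀ (W : X.Opens) (hW : W ≤ f ⁻¹ᵁ V), ((B * C).map (pull f le_rfl)).map (res hW) =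
      (B * C).map (pull f hW) := by
    intro W hW
    ext i j
    simp only [Matrix.map_apply, res_pull]
  constructor
  · intro hv
    have key : ∀ W, (F.pullback f).sec W ≤
        (kerSub (f ⁻¹ᵁ V) (1 - (B * C).map (pull f le_rfl))).sec W := by
      refine pullback_le _ _ _ fun U W hW w hw => ?_
      rw [mem_kerSub]
      intro W' hW' hW''
      have h1 := (hchar (U ⊓ V) inf_le_right (res inf_le_left ∘ w)).1 (F.res_mem _ _ hw)
      have hle : W' ≤ f ⁻¹ᵁ (U ⊓ V) := fun y hy => ⟨hW (hW' hy), hW'' hy⟩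
      have h2 := congrArg (fun a => pull f hle ∘ a) h1
      simp only [comp_mulVec] at h2
      have e1 : pull f hle ∘ (res (inf_le_left : U ⊓ V ≤ U) ∘ w) = res hW' ∘ (pull f hW ∘ w) := by
        ext j
        simp only [Function.comp_apply, pull_res, res_pull]
      have e2 : ((B * C).map (res (inf_le_right : U ⊓ V ≤ V))).map (pull f hle) =
          (B * C).map (pull f hW'') := by
        ext i j
        simp only [Matrix.map_apply, pull_res]
      rw [e1, e2] at h2
      rw [Matrix.map_sub _ (map_sub _), Matrix.map_one _ (map_zero _) (map_one _), hrp,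
        Matrix.sub_mulVec, Matrix.one_mulVec, h2, sub_self]
    have := (mem_kerSub_of_le h).1 (key V' hv)
    rw [Matrix.map_sub _ (map_sub _), Matrix.map_one _ (map_zero _) (map_one _),
      Matrix.sub_mulVec, Matrix.one_mulVec, sub_eq_zero] at this
    exact this.symm
  · intro hv
    have hb : ∀ k : Fin r, (fun i => B i k) ∈ F.sec V := by
      intro k
      rw [hchar V le_rfl]
      have hid : (res (le_refl V) : Γ(Y, V) → Γ(Y, V)) = id := by
        ext a; simp [res]
      have hk : (fun i => B i k) = B *ᵥ Pi.single k 1 := by ext i; simp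
      rw [hid, Matrix.map_id, hk, Matrix.mulVec_mulVec, Matrix.mul_assoc, hCB, Matrix.mul_one]
    rw [← hv, hrp, Matrix.map_mul, ← Matrix.mulVec_mulVec, Matrix.mulVec_eq_sum]
    simp only [op_smul_eq_smul]
    exact Submodule.sum_mem _ fun k _ =>
      Submodule.smul_mem _ _ (pull_mem_pullback f F h (hb k))

theorem quotientGeneratedBy_pullback {X Y : Scheme.{u}} {n : ℕ} (f : X ⟶ Y) {F : Subsheaf Y n}
    {J : Set (Fin n)} (hF : F.QuotientGeneratedBy J) :
    (F.pullback f).QuotientGeneratedBy J := by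
  intro V
  set G : Subsheaf X n := generate fun V : X.Opens =>
      ((F.pullback f).sec V : Set (Fin n → Γ(X, V))) ∪ {v | ∃ j ∈ J, v = Pi.single j 1} with hG
  have hsingle : ∀ (U : Y.Opens) (j : Fin n),
      pull f (le_refl (f ⁻¹ᵁ U)) ∘ (Pi.single j 1 : Fin n → Γ(Y, U)) = Pi.single j 1 :=
    fun U j => comp_single _ j
  have key : ∀ U, (⊤ : Submodule Γ(Y, U) (Fin n → Γ(Y, U))) ≤ (pushSub f G).sec U := by
    intro U
    rw [← hF U]
    refine generate_le _ (fun U w hw => ?_) U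
    change pull f (le_refl (f ⁻¹ᵁ U)) ∘ w ∈ G.sec (f ⁻¹ᵁ U)
    rcases hw with hw | ⟨j, hj, rfl⟩
    · exact subset_generate _ _ (Or.inl (pull_mem_pullback f F le_rfl hw))
    · rw [hsingle]
      exact subset_generate _ _ (Or.inr ⟨j, hj, rfl⟩)
  have hj : ∀ j : Fin n, (Pi.single j 1 : Fin n → Γ(X, V)) ∈ G.sec V := by
    intro j
    have h1 := (mem_pushSub f G _).1 (key ⊤ (Submodule.mem_top (x := Pi.single j 1)))
    rw [hsingle] at h1
    have h2 := G.res_mem (le_top : V ≤ f ⁻¹ᵁ ⊤) _ h1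
    have h3 := comp_single (res (le_top : V ≤ f ⁻¹ᵁ ⊤)) j
    exact h3 ▸ h2
  rw [eq_top_iff]
  intro v _
  rw [pi_eq_sum_univ' v]
  exact Submodule.sum_mem _ fun j _ => Submodule.smul_mem _ _ (by
    convert hj j using 1)

/-! ### The functor `M(m, n, r, (φ_i))` and the open charts `U((t_i))` -/

section functor

variable {O : Type u} [CommRing O]

/-- The structure map `O → Γ(X, V)` of an `O`-scheme `X`. -/
def scal (X : Over (Spec (.of O))) (V : X.left.Opens) : O →+* Γ(X.left, V) :=
  (pull X.hom (le_top : V ≤ X.hom ⁻¹ᵁ ⊤)).comp (Scheme.ΓSpecIso (.of O)).inv.hom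

theorem res_scal (X : Over (Spec (.of O))) {V' V : X.left.Opens} (h : V' ≤ V) (a : O) :
    res h (scal X V a) = scal X V' a := by
  exact res_pull X.hom h le_top _

theorem pull_scal {X Y : Over (Spec (.of O))} (f : X ⟶ Y) {U : Y.left.Opens} {V : X.left.Opens}
    (h : V ≤ f.left ⁻¹ᵁ U) (a : O) : pull f.left h (scal Y U a) = scal X V a := by
  simp only [scal, RingHom.comp_apply]
  rw [pull_pull (U := ⊤) f.left Y.hom h le_top le_top]
  have hw : ∀ (g g' : X.left ⟶ Spec (.of O)) (_ : g = g') (h₁ : V ≤ g ⁻¹ᵁ ⊤) (h₂ : V ≤ g' ⁻¹ᵁ ⊤),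
      pull g h₁ = pull g' h₂ := by
    rintro g _ rfl _ _
    rfl
  exact congrFun (congrArg DFunLike.coe (hw _ _ (Over.w f) _ _)) _

/-- The `O`-linear map `A : O ^ n → O ^ n`, base changed to the `O`-scheme `X`, maps the
subsheaf `F` into the subsheaf `F'`. -/
def MapsInto {n : ℕ} (X : Over (Spec (.of O))) (A : Matrix (Fin n) (Fin n) O)
    (F F' : Subsheaf X.left n) : Prop :=
  ∀ V : X.left.Opens, ∀ v ∈ F.sec V, A.map (scal X V) *ᵥ v ∈ F'.sec V

theorem mapsInto_pullback {n : ℕ} {X Y : Over (Spec (.of O))} (f : X ⟶ Y)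
    {A : Matrix (Fin n) (Fin n) O} {F F' : Subsheaf Y.left n} (h : MapsInto Y A F F') :
    MapsInto X A (F.pullback f.left) (F'.pullback f.left) := by
  have hA : ∀ {V' V : X.left.Opens} (hV : V' ≤ V),
      (A.map (scal X V)).map (res hV) = A.map (scal X V') := by
    intro V' V hV
    apply Matrix.ext
    intro i j
    simp only [Matrix.map_apply, res_scal]
  have hA' : ∀ {U : Y.left.Opens} {V : X.left.Opens} (hV : V ≤ f.left ⁻¹ᵁ U),
      (A.map (scal Y U)).map (pull f.left hV) = A.map (scal X V) := by
    intro U V hV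
    apply Matrix.ext
    intro i j
    simp only [Matrix.map_apply, pull_scal]
  let G : Subsheaf X.left n :=
    { sec := fun V => ((F'.pullback f.left).sec V).comap (A.map (scal X V)).mulVecLin
      res_mem := fun {V' V} hV v hv => by
        simp only [Submodule.mem_comap, Matrix.mulVecLin_apply] at hv ⊢
        have := (F'.pullback f.left).res_mem hV _ hv
        rwa [comp_mulVec, hA] at this
      mem_of_local := fun V v hv => by
        simp only [Submodule.mem_comap, Matrix.mulVecLin_apply] at hv ⊢
        refine (F'.pullback f.left).mem_of_local _ _ fun x hx => ?_
        obtain ⟨V', hV, hx', hm⟩ := hv x hx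
        refine ⟨V', hV, hx', ?_⟩
        rwa [comp_mulVec, hA] }
  have key : ∀ V, (F.pullback f.left).sec V ≤ G.sec V := by
    refine pullback_le _ _ _ fun U V hV w hw => ?_
    have := pull_mem_pullback f.left F' hV (h U w hw)
    rw [comp_mulVec, hA'] at this
    exact this
  exact fun V v hv => key V hv

/-- The functor `M(m, n, r, (φ_i))` on `O`-schemes: with `Λ_i = O ^ n` for `i ∈ ℤ / m`, and with
`φ_i : Λ_i → Λ_{i+1}` given by matrices (with respect to the standard bases), it sends an
`O`-scheme `X` to the set of tuples `(F_i)` of `𝒪_X`-submodules `F_i ⊆ Λ_{i,X} = 𝒪_X ^ n` which are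
locally free of rank `r`, are Zariski-locally direct summands, and satisfy `φ_i(F_i) ⊆ F_{i+1}`. -/
def compatibleSubspaces {m : ℕ} [NeZero m] (n r : ℕ) (φ : Fin m → Matrix (Fin n) (Fin n) O) :
    (Over (Spec (.of O)))ᵒᵖ ⥤ Type u where
  obj X := {F : Fin m → Subsheaf X.unop.left n //
    (∀ i, (F i).IsLocallyFree r ∧ (F i).IsLocallyDirectSummand) ∧
      ∀ i, MapsInto X.unop (φ i) (F i) (F (i + 1))}
  map f := ↾fun F => ⟨fun i => (F.1 i).pullback f.unop.left,
    fun i => pullback_isLocallyFree f.unop.left (F.2.1 i),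
    fun i => mapsInto_pullback f.unop (F.2.2 i)⟩
  map_id X := by
    refine ConcreteCategory.hom_ext _ _ fun F => ?_
    exact Subtype.ext (funext fun i => pullback_id (F.1 i))
  map_comp f g := by
    refine ConcreteCategory.hom_ext _ _ fun F => ?_
    exact Subtype.ext (funext fun i => pullback_comp g.unop.left f.unop.left (F.1 i))

/-- The open subfunctor `U((t_i))` of `M(m, n, r, (φ_i))`: the locus where, for each `i`,
the quotient `Λ_i / F_i` is generated by the basis vectors `e_j` with `t_i(j) = 0`. -/
def chart {m : ℕ} [NeZero m] (n r : ℕ) (φ : Fin m → Matrix (Fin n) (Fin n) O)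
    (t : Fin m → Fin n → Fin 2) : Subfunctor (compatibleSubspaces n r φ) where
  obj _ := {F | ∀ i, (F.1 i).QuotientGeneratedBy {j | t i j = 0}}
  map f _ hF i := quotientGeneratedBy_pullback f.unop.left (hF i)

/-! ### Generalized local models and admissible index data -/

/-- The cyclic product `X_{i+m-1} ⋯ X_{i+1} X_i`, with indices in `ℤ / m`. -/
def cyclicProd {A : Type*} [Monoid A] {m : ℕ} [NeZero m] (X : Fin m → A) (i : Fin m) : A :=
  (List.ofFn fun k : Fin m => X (i + k)).reverse.prod

/-- `M(m, n, r, (φ_i))` is a generalized local model: the `φ_i` are diagonal matrices with only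
`1`'s and `π`'s on the diagonal, and their composition `φ_{m-1} ⋯ φ_0` is `π`. -/
def IsGeneralizedLocalModel (π : O) {m n : ℕ} [NeZero m]
    (φ : Fin m → Matrix (Fin n) (Fin n) O) : Prop :=
  (∀ i, ∃ d : Fin n → O, (∀ j, d j = 1 ∨ d j = π) ∧ φ i = Matrix.diagonal d) ∧
    cyclicProd φ 0 = π • (1 : Matrix (Fin n) (Fin n) O)

/-- The conditions on the vectors `t_i ∈ {0, 1} ^ n`. -/
structure IsAdmissible (π : O) {m n : ℕ} [NeZero m] (r : ℕ)
    (φ : Fin m → Matrix (Fin n) (Fin n) O) (t : Fin m → Fin n → Fin 2) : Prop where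
  /-- Each `t_i` has exactly `r` entries equal to `1`. -/
  card_eq : ∀ i, (Finset.univ.filter fun j => t i j = 1).card = r
  /-- For each `j`, the sequence `(t_0(j), …, t_{m-1}(j))` is a cyclic permutation of
  `(1 ^ κ, 0 ^ (m - κ))` for some `κ`. -/
  cyclic : ∀ j, ∃ κ ≤ m, ∃ c : Fin m, ∀ i : Fin m, t (i + c) j = 1 ↔ (i : ℕ) < κ
  /-- If `t_i(j) = 1` and `t_{i+1}(j) = 0`, then `φ_i(e_j) = π e_j`. -/
  drop : ∀ i j, t i j = 1 → t (i + 1) j = 0 → φ i *ᵥ Pi.single j 1 = π • Pi.single j 1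

/-- The set `{j | t_i(j) = a for all i}`. -/
def constSet {m n : ℕ} (t : Fin m → Fin n → Fin 2) (a : Fin 2) : Finset (Fin n) :=
  Finset.univ.filter fun j => ∀ i, t i j = a

/-! ### The schemes `W` and `W × 𝔸 ^ d` -/

/-- The generic `N × N`-matrices `X_0, …, X_{m-1}`. -/
def genericMatrix (O : Type u) [CommRing O] (m N : ℕ) (i : Fin m) :
    Matrix (Fin N) (Fin N) (MvPolynomial (Fin m × Fin N × Fin N) O) :=
  Matrix.of fun μ ν => MvPolynomial.X (i, μ, ν)

/-- The equations of `∏ 𝔛_i` in the space of `m`-tuples of `N × N`-matrices. Here `jj i` enumerates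
the indices `j` labelling the rows and columns at `i`. The `ι`-th column of `X_i`, with label
`j = jj i ι`, is prescribed if `t_{i+1}(j) = 0`: its entries are
`x_{μ,ι} = φ_i(j,j) δ_{μ,ι'}`, where `jj (i+1) ι' = j`. -/
def columnEquations {m n N : ℕ} [NeZero m] (φ : Fin m → Matrix (Fin n) (Fin n) O)
    (t : Fin m → Fin n → Fin 2) (jj : Fin m → Fin N → Fin n) :
    Set (MvPolynomial (Fin m × Fin N × Fin N) O) :=
  {p | ∃ (i : Fin m) (μ ι : Fin N), t (i + 1) (jj i ι) = 0 ∧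
    p = genericMatrix O m N i μ ι -
      MvPolynomial.C (if jj (i + 1) μ = jj i ι then φ i (jj i ι) (jj i ι) else 0)}

/-- The entries of the matrices `X_{i+m-1} ⋯ X_{i+1} X_i - π`, for all `i ∈ ℤ / m`. -/
def productEquations (π : O) (m N : ℕ) [NeZero m] :
    Set (MvPolynomial (Fin m × Fin N × Fin N) O) :=
  {p | ∃ (i : Fin m) (μ ν : Fin N),
    p = cyclicProd (genericMatrix O m N) i μ ν - MvPolynomial.C (if μ = ν then π else 0)}

/-- The affine `O`-scheme `W` of tuples `(X_i) ∈ ∏ 𝔛_i` all of whose cyclic products are `π`. -/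
def schemeW (π : O) {m n N : ℕ} [NeZero m] (φ : Fin m → Matrix (Fin n) (Fin n) O)
    (t : Fin m → Fin n → Fin 2) (jj : Fin m → Fin N → Fin n) : Over (Spec (.of O)) :=
  Over.mk (Spec.map (CommRingCat.ofHom (algebraMap O
    (MvPolynomial (Fin m × Fin N × Fin N) O ⧸
      Ideal.span (columnEquations φ t jj ∪ productEquations π m N)))))

/-- The fibre product `Z × 𝔸 ^ d` over `O`. -/
def timesAffineSpace (Z : Over (Spec (.of O))) (d : ℕ) : Over (Spec (.of O)) :=
  Over.mk (Limits.pullback.fst Z.hom (𝔸(ULift.{u} (Fin d); Spec (.of O)) ↘ Spec (.of O)) ≫ Z.hom)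

end functor

end LocalModel

end

universe v w

set_option linter.unusedSectionVars false

namespace LocalModel

/-! ### Cyclic products and orbits -/

section cyclic

variable {m : ℕ} [NeZero m]

/-! Write O_i = {t_i = 1}, let S and T be the sets of indices where all t_i are 0, respectively 1,
and let Z_i = {t_i = 0} \ S. On the chart, F_i projects isomorphically onto the coordinates in O_i,
so F_i is the graph of a unique matrix A_i of global functions with columns in O_i and rows in Z_i ∪
S (`exists_eq_graphSub`). With 1_Z a coordinate projection and D_i the diagonal matrix of φ_i, the
map 1_{Z_i ∪ S} - A_i is a projection with kernel F_i and 1_{O_i} + A_i is one with image F_i.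
Compatibility becomes the matrix equation (1_{Z_{i+1} ∪ S} - A_{i+1}) D_i (1_{O_i} + A_i) = 0.

Since π is irreducible, each j has exactly one place p_j where φ multiplies e_j by π; elsewhere it
multiplies by 1. Condition (ii) then says that j can leave the sets O_i only in the step from p_j to
p_j + 1 (`isDropData`).

The rows in S can be set aside (`isGraphFamily_union_iff`). The remaining family induces maps Y_i on
the quotients, identified with R^{Z_i}; their cyclic products are π because those of the φ_i are. In
coordinates these are the X_i. Conversely P_i = 1_{Z_i} - A_i satisfies Y_i P_i = P_{i+1} D_i. So
column j of P is an orbit of the Y_i starting at p_j + 1, and the only closing condition, at p_j, is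
the cyclic product equation. If j ∈ Z_{p_j+1} the initial column is e_j; otherwise j ∈ T and the
initial column is arbitrary, which gives N free parameters per element of T (`graph_unique`,
`exists_graph`).

A row k ∈ S satisfies g_{i+1} L_i = d_i(k) g_i, where L_i is the map induced on the graphs and
d_i(k) the diagonal entry of φ_i. The same argument run backwards from p_k leaves exactly the row at
p_k free, which gives r parameters per element of S (`existsUnique_graph`). The correspondence
commutes with base change, so it is an isomorphism of functors (`chart_iso`). -/

theorem add_ofNat_succ (i : Fin m) (l : ℕ) :
    i + Fin.ofNat m (l + 1) = i + Fin.ofNat m l + 1 := by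
  rw [add_assoc]
  congr 1
  ext
  simp [Fin.val_add]

theorem ofNat_card : Fin.ofNat m m = 0 := by
  ext; simp

/-- The product `X_{i+l-1} ⋯ X_{i+1} X_i`, with indices in `ℤ / m`. -/
def iterProd {A : Type*} [Monoid A] (X : Fin m → A) (i : Fin m) : ℕ → A
  | 0 => 1
  | l + 1 => X (i + Fin.ofNat m l) * iterProd X i l

theorem iterProd_succ' {A : Type*} [Monoid A] (X : Fin m → A) (i : Fin m) (l : ℕ) :
    iterProd X i (l + 1) = iterProd X (i + 1) l * X i := by
  induction l with
  | zero => simp [iterProd]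
  | succ l ih =>
    rw [iterProd, ih, iterProd, mul_assoc, add_ofNat_succ, add_right_comm]

theorem cyclicProd_eq_iterProd {A : Type*} [Monoid A] (X : Fin m → A) (i : Fin m) :
    cyclicProd X i = iterProd X i m := by
  have key : ∀ l : ℕ, (List.ofFn fun k : Fin l => X (i + Fin.ofNat m k)).reverse.prod =
      iterProd X i l := by
    intro l
    induction l with
    | zero => simp [iterProd]
    | succ l ih =>
      rw [List.ofFn_succ', List.concat_eq_append, List.reverse_append, iterProd, ← ih]
      simp
  rw [← key, cyclicProd]
  simp

theorem iterProd_intertwine {R : Type*} [CommRing R] {I J : Type*} [Fintype I] [Fintype J]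
    [DecidableEq I] [DecidableEq J] {Y : Fin m → Matrix I I R} {X : Fin m → Matrix J J R}
    {U : Fin m → Matrix I J R} (h : ∀ i, Y i * U i = U (i + 1) * X i) (i : Fin m) (l : ℕ) :
    iterProd Y i l * U i = U (i + Fin.ofNat m l) * iterProd X i l := by
  induction l with
  | zero =>
    simp [iterProd]
  | succ l ih =>
    rw [iterProd, iterProd, Matrix.mul_assoc, ih, ← Matrix.mul_assoc, h, Matrix.mul_assoc,
      add_ofNat_succ]

/-- After a full turn the intertwiner returns to its own index. This is how the equation "all cyclic
products are π" is carried between the φ_i, the maps induced on quotients and graphs, and the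
matrices X_i. -/
theorem cyclicProd_intertwine {R : Type*} [CommRing R] {I J : Type*} [Fintype I] [Fintype J]
    [DecidableEq I] [DecidableEq J] {Y : Fin m → Matrix I I R} {X : Fin m → Matrix J J R}
    {U : Fin m → Matrix I J R} (h : ∀ i, Y i * U i = U (i + 1) * X i) (i : Fin m) :
    cyclicProd Y i * U i = U i * cyclicProd X i := by
  rw [cyclicProd_eq_iterProd, cyclicProd_eq_iterProd, iterProd_intertwine h, ofNat_card, add_zero]

theorem cyclicProd_map {A B : Type*} [Monoid A] [Monoid B] (f : A →* B) (X : Fin m → A)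
    (i : Fin m) : f (cyclicProd X i) = cyclicProd (fun k => f (X k)) i := by
  simp [cyclicProd, map_list_prod, List.map_reverse, List.map_ofFn, Function.comp_def]

theorem cyclicProd_diagonal {R : Type*} [CommRing R] {J : Type*} [Fintype J] [DecidableEq J]
    (d : Fin m → J → R) (i : Fin m) :
    cyclicProd (fun k => Matrix.diagonal (d k)) i = Matrix.diagonal fun j => ∏ k, d k j := by
  have h := cyclicProd_map (Matrix.diagonalRingHom J R).toMonoidHom d i
  have h' : cyclicProd d i = fun j => ∏ k, d k j := by
    funext j
    rw [cyclicProd, List.prod_reverse, List.prod_ofFn, Finset.prod_apply]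
    exact Fintype.prod_equiv (Equiv.addLeft i) _ _ fun k => rfl
  rw [h'] at h
  exact h.symm

/-- Walking p + 1, p + 2, …, p exhausts ℤ/m without ever stepping from p to p + 1, the one step
where the scalar may be π. -/
theorem cyclic_induction {Q : Fin m → Prop} (p : Fin m) (h0 : Q (p + 1))
    (h : ∀ i, i ≠ p → Q i → Q (i + 1)) (i : Fin m) : Q i := by
  have key : ∀ l < m, Q (p + 1 + Fin.ofNat m l) := by
    intro l
    induction l with
    | zero =>
      intro _
      have : Fin.ofNat m 0 = 0 := rfl
      rwa [this, add_zero]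
    | succ l ih =>
      intro hl
      rw [add_ofNat_succ]
      refine h _ (fun hp => ?_) (ih (by omega))
      -- Being at p would force m to divide l + 1, although 0 < l + 1 < m.
      rw [add_right_comm, ← add_ofNat_succ, add_eq_left] at hp
      have := congrArg Fin.val hp
      simp [Nat.mod_eq_of_lt hl] at this
  have := key (i - (p + 1)).val (i - (p + 1)).isLt
  simpa using this

theorem cyclic_induction_down {Q : Fin m → Prop} (p : Fin m) (h0 : Q p)
    (h : ∀ i, i ≠ p → Q (i + 1) → Q i) (i : Fin m) : Q i := by
  have := cyclic_induction (Q := fun i => Q (-i)) (-p - 1) (by simpa using h0) (fun i hi hQ => by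
    rw [neg_add]
    refine h _ (fun hp => hi ?_) ?_
    · rw [← hp]; abel
    · simpa using hQ) (-i)
  simpa using this

theorem val_eq_val_sub_one_succ {x : Fin m} (h : x ≠ 0) : x.val = (x - 1).val + 1 := by
  obtain ⟨k, rfl⟩ : ∃ k, m = k + 1 := Nat.exists_eq_succ_of_ne_zero (NeZero.ne m)
  rw [Fin.val_sub_one_of_ne_zero h]
  have := Fin.val_ne_zero_iff.2 h
  omega

theorem val_neg_one_succ : (-1 : Fin m).val + 1 = m := by
  obtain ⟨k, rfl⟩ : ∃ k, m = k + 1 := Nat.exists_eq_succ_of_ne_zero (NeZero.ne m)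
  simp [Fin.coe_neg_one]

section orbit

variable {R : Type*} [CommRing R] {J : Type*} [Fintype J] [DecidableEq J]
  {Y : Fin m → Matrix J J R} {d : Fin m → R} {p : Fin m} {a : R}

/-- The relations at i ≠ p define c from its value at p + 1. The relation at p closes the circle,
and it is the eigenvector condition on v, so no division by `a` is needed. -/
theorem exists_orbit (hp : d p = a) (hd : ∀ i, i ≠ p → d i = 1) {v : J → R}
    (hv : cyclicProd Y (p + 1) *ᵥ v = a • v) :
    ∃ c : Fin m → J → R, c (p + 1) = v ∧ ∀ i, Y i *ᵥ c i = d i • c (i + 1) := by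
  refine ⟨fun i => iterProd Y (p + 1) (i - (p + 1)).val *ᵥ v, by simp [iterProd], fun i => ?_⟩
  have hi : p + 1 + Fin.ofNat m (i - (p + 1)).val = i := by simp
  by_cases h : i = p
  · subst h
    have h1 : (i - (i + 1)).val + 1 = m := by
      rw [show i - (i + 1) = -1 by abel, val_neg_one_succ]
    have h2 : Y i * iterProd Y (i + 1) (i - (i + 1)).val = cyclicProd Y (i + 1) := by
      conv_rhs => rw [cyclicProd_eq_iterProd]
      rw [← congrArg (iterProd Y (i + 1)) h1, iterProd, hi]
    rw [Matrix.mulVec_mulVec, h2, hv, hp]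
    simp [iterProd]
  · have h1 := val_eq_val_sub_one_succ (sub_ne_zero.2 h)
    rw [← sub_add_eq_sub_sub, show i - p = i + 1 - (p + 1) by abel] at h1
    beta_reduce
    rw [hd i h, one_smul, h1, iterProd, hi, Matrix.mulVec_mulVec]

/-- Row vectors propagate in the opposite direction: the value at p determines those at p - 1, p -
2, …, and the starting place is p instead of p + 1. -/
theorem exists_orbit_row (hp : d p = a) (hd : ∀ i, i ≠ p → d i = 1) {v : J → R}
    (hv : v ᵥ* cyclicProd Y p = a • v) :
    ∃ c : Fin m → J → R, c p = v ∧ ∀ i, c (i + 1) ᵥ* Y i = d i • c i := by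
  refine ⟨fun i => v ᵥ* iterProd Y i (p - i).val, by simp [iterProd], fun i => ?_⟩
  rw [Matrix.vecMul_vecMul, ← iterProd_succ']
  by_cases h : i = p
  · subst h
    have h1 : (i - (i + 1)).val + 1 = m := by
      rw [show i - (i + 1) = -1 by abel, val_neg_one_succ]
    rw [h1, ← cyclicProd_eq_iterProd, hv, hp]
    simp [iterProd]
  · have h1 := val_eq_val_sub_one_succ (sub_ne_zero.2 (Ne.symm h))
    rw [← sub_add_eq_sub_sub] at h1
    beta_reduce
    rw [hd i h, one_smul, h1]

end orbit

end cyclic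

/-! ### Families of graphs -/

section graph

variable {R : Type*} [CommRing R] {J : Type*} [Fintype J] [DecidableEq J]

/-- The projection of `R ^ J` onto the coordinates in `s`. -/
def coordProj (R : Type*) [CommRing R] (s : Finset J) : Matrix J J R :=
  Matrix.diagonal fun j => if j ∈ s then 1 else 0

theorem coordProj_mul_apply {I : Type*} (s : Finset J) (A : Matrix J I R) (i : J) (j : I) :
    (coordProj R s * A) i j = if i ∈ s then A i j else 0 := by
  simp [coordProj, Matrix.diagonal_mul]

theorem mul_coordProj_apply (s : Finset J) (A : Matrix J J R) (i j : J) :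
    (A * coordProj R s) i j = if j ∈ s then A i j else 0 := by
  simp [coordProj, Matrix.mul_diagonal]

theorem coordProj_apply (s : Finset J) (i j : J) :
    coordProj R s i j = if i = j ∧ j ∈ s then 1 else 0 := by
  by_cases h : i = j <;> simp [coordProj, h]

theorem coordProj_mulVec_apply (s : Finset J) (v : J → R) (i : J) :
    (coordProj R s *ᵥ v) i = if i ∈ s then v i else 0 := by
  simp [coordProj, Matrix.mulVec_diagonal]

theorem coordProj_mul_coordProj (s s' : Finset J) :
    coordProj R s * coordProj R s' = coordProj R (s ∩ s') := by
  ext i j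
  rw [coordProj_mul_apply, coordProj_apply, coordProj_apply]
  by_cases h : i = j
  · subst h
    by_cases h1 : i ∈ s <;> simp [h1]
  · simp [h]

theorem coordProj_empty : coordProj R (∅ : Finset J) = 0 := by
  ext i j; simp [coordProj_apply]

theorem coordProj_univ : coordProj R (Finset.univ : Finset J) = 1 := by
  ext i j; simp [coordProj_apply, Matrix.one_apply]

theorem coordProj_union {s s' : Finset J} (h : Disjoint s s') :
    coordProj R (s ∪ s') = coordProj R s + coordProj R s' := by
  ext i j
  rw [Matrix.add_apply, coordProj_apply, coordProj_apply, coordProj_apply]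
  by_cases h0 : i = j
  · by_cases h1 : j ∈ s
    · simp [h0, h1, Finset.disjoint_left.1 h h1]
    · simp [h0, h1]
  · simp [h0]

theorem coordProj_commute_diagonal (s : Finset J) (d : J → R) :
    coordProj R s * Matrix.diagonal d = Matrix.diagonal d * coordProj R s := by
  rw [coordProj, Matrix.diagonal_mul_diagonal, Matrix.diagonal_mul_diagonal]
  simp [mul_comm]

/-- `A` has its rows in `Z` and its columns in `O`. -/
def IsSupported (Z O : Finset J) (A : Matrix J J R) : Prop :=
  coordProj R Z * A = A ∧ A * coordProj R O = A

theorem isSupported_iff {Z O : Finset J} {A : Matrix J J R} :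
    IsSupported Z O A ↔ ∀ z j, A z j ≠ 0 → z ∈ Z ∧ j ∈ O := by
  constructor
  · rintro ⟨h1, h2⟩ z j h
    rw [← h1, coordProj_mul_apply] at h
    have hz : z ∈ Z := by by_contra hz; simp [hz] at h
    rw [if_pos hz, ← h2, mul_coordProj_apply] at h
    exact ⟨hz, by by_contra hj; simp [hj] at h⟩
  · intro h
    constructor
    · ext z j
      rw [coordProj_mul_apply]
      by_cases h0 : A z j = 0
      · simp [h0]
      · rw [if_pos (h z j h0).1]
    · ext z j
      rw [mul_coordProj_apply]
      by_cases h0 : A z j = 0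
      · simp [h0]
      · rw [if_pos (h z j h0).2]

theorem IsSupported.apply_eq_zero {Z O : Finset J} {A : Matrix J J R} (h : IsSupported Z O A)
    {z j : J} (hzj : ¬(z ∈ Z ∧ j ∈ O)) : A z j = 0 := by
  by_contra h0
  exact hzj (isSupported_iff.1 h z j h0)

section one

variable {Z O : Finset J} {A B : Matrix J J R}

theorem IsSupported.mul_coordProj (hA : IsSupported Z O A) (hZO : Disjoint Z O) :
    A * coordProj R Z = 0 := by
  rw [← hA.2, Matrix.mul_assoc, coordProj_mul_coordProj, Finset.inter_comm,
    Finset.disjoint_iff_inter_eq_empty.1 hZO, coordProj_empty, Matrix.mul_zero]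

theorem IsSupported.coordProj_mul (hA : IsSupported Z O A) (hZO : Disjoint Z O) :
    coordProj R O * A = 0 := by
  rw [← hA.1, ← Matrix.mul_assoc, coordProj_mul_coordProj, Finset.inter_comm,
    Finset.disjoint_iff_inter_eq_empty.1 hZO, coordProj_empty, Matrix.zero_mul]

theorem IsSupported.mul_eq_zero (hA : IsSupported Z O A) (hB : IsSupported Z O B)
    (hZO : Disjoint Z O) : A * B = 0 := by
  rw [← hA.2, Matrix.mul_assoc, hB.coordProj_mul hZO, Matrix.mul_zero]

theorem coordProj_self_mul (s : Finset J) : coordProj R s * coordProj R s = coordProj R s := by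
  rw [coordProj_mul_coordProj, Finset.inter_self]

theorem coordProj_disjoint_mul (hZO : Disjoint Z O) : coordProj R Z * coordProj R O = 0 := by
  rw [coordProj_mul_coordProj, Finset.disjoint_iff_inter_eq_empty.1 hZO, coordProj_empty]

/-- `(1_Z - A) (1_O + B) = B - A` -/
theorem sub_mul_add (hA : IsSupported Z O A) (hB : IsSupported Z O B) (hZO : Disjoint Z O) :
    (coordProj R Z - A) * (coordProj R O + B) = B - A := by
  rw [Matrix.sub_mul, Matrix.mul_add, Matrix.mul_add, hA.2, hB.1, hA.mul_eq_zero hB hZO,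
    coordProj_disjoint_mul hZO]
  abel

theorem sub_mul_coordProj (hA : IsSupported Z O A) (hZO : Disjoint Z O) :
    (coordProj R Z - A) * coordProj R Z = coordProj R Z := by
  rw [Matrix.sub_mul, hA.mul_coordProj hZO, coordProj_self_mul, sub_zero]

theorem coordProj_mul_sub (hA : IsSupported Z O A) :
    coordProj R Z * (coordProj R Z - A) = coordProj R Z - A := by
  rw [Matrix.mul_sub, hA.1, coordProj_self_mul]

theorem coordProj_mul_add (hA : IsSupported Z O A) (hZO : Disjoint Z O) :
    coordProj R O * (coordProj R O + A) = coordProj R O := by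
  rw [Matrix.mul_add, hA.coordProj_mul hZO, coordProj_self_mul, add_zero]

theorem add_mul_coordProj (hA : IsSupported Z O A) :
    (coordProj R O + A) * coordProj R O = coordProj R O + A := by
  rw [Matrix.add_mul, hA.2, coordProj_self_mul]

theorem sub_mul_coordProj_union (hA : IsSupported Z O A) (hZO : Disjoint Z O) :
    (coordProj R Z - A) * coordProj R (Z ∪ O) = coordProj R Z - A := by
  rw [coordProj_union hZO, Matrix.mul_add, sub_mul_coordProj hA hZO, Matrix.sub_mul,
    coordProj_disjoint_mul hZO, hA.2, zero_sub, sub_eq_add_neg]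

theorem coordProj_union_mul_add (hA : IsSupported Z O A) (hZO : Disjoint Z O) :
    coordProj R (Z ∪ O) * (coordProj R O + A) = coordProj R O + A := by
  rw [coordProj_union hZO, Matrix.add_mul, coordProj_mul_add hA hZO, Matrix.mul_add,
    coordProj_disjoint_mul hZO, hA.1, zero_add, add_comm]

/-- On the coordinates in Z ∪ O these are complementary projections: the kernel of the first and the
image of the second are both the graph of `A`. The first identifies the quotient by the graph with
R^Z, the second identifies R^O with the graph. -/
theorem sub_add_add (hZO : Disjoint Z O) :
    (coordProj R Z - A) + (coordProj R O + A) = coordProj R (Z ∪ O) := by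
  rw [coordProj_union hZO]
  abel

end one

variable {m : ℕ} [NeZero m]

/-- The graphs `F_i` of the matrices `A_i`, with columns in `O_i` and rows in `Z_i`, satisfy
`diag(d_i) F_i ⊆ F_{i+1}`. -/
def IsGraphFamily (Z O : Fin m → Finset J) (d : Fin m → J → R) (A : Fin m → Matrix J J R) : Prop :=
  (∀ i, IsSupported (Z i) (O i) (A i)) ∧ ∀ i,
    (coordProj R (Z (i + 1)) - A (i + 1)) * Matrix.diagonal (d i) * (coordProj R (O i) + A i) = 0

/-- The matrix of the map induced on the quotients by the graphs. -/
def quotMap (Z : Fin m → Finset J) (d : Fin m → J → R) (A : Fin m → Matrix J J R) (i : Fin m) :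
    Matrix J J R :=
  (coordProj R (Z (i + 1)) - A (i + 1)) * Matrix.diagonal (d i) * coordProj R (Z i)

/-- The matrix of the map induced on the graphs. -/
def subMap (O : Fin m → Finset J) (d : Fin m → J → R) (A : Fin m → Matrix J J R) (i : Fin m) :
    Matrix J J R :=
  coordProj R (O (i + 1)) * Matrix.diagonal (d i) * (coordProj R (O i) + A i)

section family

variable {Z O : Fin m → Finset J} {d : Fin m → J → R} {A B : Fin m → Matrix J J R} {K : Finset J}

/-- The map diag(d_i) descends to the quotients by the graphs exactly when it maps graph into graph.
The two sides of the first equation differ by the third expression, as 1_K = (1_Z - A) + (1_O + A).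
-/
theorem quotMap_mul (hA : ∀ i, IsSupported (Z i) (O i) (A i)) (hZO : ∀ i, Disjoint (Z i) (O i))
    (hK : ∀ i, Z i ∪ O i = K) (i : Fin m) :
    quotMap Z d A i * (coordProj R (Z i) - A i) =
        (coordProj R (Z (i + 1)) - A (i + 1)) * Matrix.diagonal (d i) ↔
    (coordProj R (Z (i + 1)) - A (i + 1)) * Matrix.diagonal (d i) * (coordProj R (O i) + A i)
      = 0 := by
  have h1 : (coordProj R (Z (i + 1)) - A (i + 1)) * Matrix.diagonal (d i) =
      (coordProj R (Z (i + 1)) - A (i + 1)) * Matrix.diagonal (d i) * coordProj R K := by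
    rw [Matrix.mul_assoc, ← coordProj_commute_diagonal, ← Matrix.mul_assoc, ← hK (i + 1),
      sub_mul_coordProj_union (hA _) (hZO _)]
  conv_lhs => rhs; rw [h1]
  rw [quotMap, Matrix.mul_assoc _ (coordProj R (Z i)), coordProj_mul_sub (hA i), ← hK i,
    ← sub_add_add (A := A i) (hZO i), Matrix.mul_add, left_eq_add]

/-- Dual to `quotMap_mul`: the decomposition of 1_K is now inserted on the target side, at i + 1. -/
theorem mul_subMap (hA : ∀ i, IsSupported (Z i) (O i) (A i)) (hZO : ∀ i, Disjoint (Z i) (O i))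
    (hK : ∀ i, Z i ∪ O i = K) (i : Fin m) :
    (coordProj R (O (i + 1)) + A (i + 1)) * subMap O d A i =
        Matrix.diagonal (d i) * (coordProj R (O i) + A i) ↔
    (coordProj R (Z (i + 1)) - A (i + 1)) * Matrix.diagonal (d i) * (coordProj R (O i) + A i)
      = 0 := by
  have h1 : Matrix.diagonal (d i) * (coordProj R (O i) + A i) =
      coordProj R K * (Matrix.diagonal (d i) * (coordProj R (O i) + A i)) := by
    rw [← Matrix.mul_assoc, coordProj_commute_diagonal, Matrix.mul_assoc, ← hK i,
      coordProj_union_mul_add (hA _) (hZO _)]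
  conv_lhs => rhs; rw [h1]
  rw [subMap, Matrix.mul_assoc (coordProj R (O (i + 1))), ← Matrix.mul_assoc _ (coordProj R _),
    add_mul_coordProj (hA _), ← hK (i + 1), ← sub_add_add (A := A (i + 1)) (hZO _),
    Matrix.add_mul (coordProj R (Z (i + 1)) - A (i + 1)), right_eq_add, Matrix.mul_assoc]

variable {a : R}

/-- The projections 1_Z - A intertwine the quotient maps with the diagonal matrices, whose cyclic
products are the scalar `a`. Since (1_Z - A) 1_Z = 1_Z, multiplying by 1_Z on the right removes the
intertwiner. -/
theorem cyclicProd_quotMap (hA : IsGraphFamily Z O d A) (hZO : ∀ i, Disjoint (Z i) (O i))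
    (hK : ∀ i, Z i ∪ O i = K) (hd : ∀ j, ∏ i, d i j = a) (i : Fin m) :
    cyclicProd (quotMap Z d A) i * coordProj R (Z i) = a • coordProj R (Z i) := by
  have h := cyclicProd_intertwine (U := fun i => coordProj R (Z i) - A i)
    (fun i => (quotMap_mul hA.1 hZO hK i).2 (hA.2 i)) i
  have h2 := congrArg (· * coordProj R (Z i)) h
  simp only [Matrix.mul_assoc, sub_mul_coordProj (hA.1 i) (hZO i)] at h2
  rw [h2, cyclicProd_diagonal]
  simp only [hd]
  rw [← Matrix.smul_one_eq_diagonal, Matrix.smul_mul, Matrix.one_mul, Matrix.mul_smul,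
    sub_mul_coordProj (hA.1 i) (hZO i)]

theorem cyclicProd_subMap (hA : IsGraphFamily Z O d A) (hZO : ∀ i, Disjoint (Z i) (O i))
    (hK : ∀ i, Z i ∪ O i = K) (hd : ∀ j, ∏ i, d i j = a) (i : Fin m) :
    coordProj R (O i) * cyclicProd (subMap O d A) i = a • coordProj R (O i) := by
  have h := cyclicProd_intertwine (U := fun i => coordProj R (O i) + A i)
    (fun i => ((mul_subMap hA.1 hZO hK i).2 (hA.2 i)).symm) i
  have h2 := congrArg (coordProj R (O i) * ·) h
  simp only [← Matrix.mul_assoc, coordProj_mul_add (hA.1 i) (hZO i)] at h2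
  rw [← h2, cyclicProd_diagonal]
  simp only [hd]
  rw [← Matrix.smul_one_eq_diagonal, Matrix.mul_smul, Matrix.mul_one, Matrix.smul_mul,
    coordProj_mul_add (hA.1 i) (hZO i)]

end family

end graph

/-! ### Reconstruction of a graph family from its quotient maps -/

section reconstruct

variable {R : Type*} [CommRing R] {J : Type*} [Fintype J] [DecidableEq J] {m : ℕ} [NeZero m]

/-- For each `j`, the scalar `d_i(j)` is `a` for `i = p_j` and `1` otherwise, and the cyclic sequence
`i ↦ [j ∈ O_i]` can drop only at `p_j`. -/
structure IsDropData (a : R) (Z O : Fin m → Finset J) (K : Finset J) (d : Fin m → J → R)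
    (p : J → Fin m) : Prop where
  disj : ∀ i, Disjoint (Z i) (O i)
  union : ∀ i, Z i ∪ O i = K
  eq_a : ∀ j, d (p j) j = a
  eq_one : ∀ j i, i ≠ p j → d i j = 1
  mono : ∀ i j, j ∈ O i → i ≠ p j → j ∈ O (i + 1)

variable {a : R} {Z O : Fin m → Finset J} {K : Finset J} {d : Fin m → J → R} {p : J → Fin m}
  {A B : Fin m → Matrix J J R}

namespace IsDropData

variable (h : IsDropData a Z O K d p)
include h

theorem prod_eq (j : J) : ∏ i, d i j = a := by
  rw [Finset.prod_eq_single (p j) (fun i _ hi => h.eq_one j i hi) (by simp), h.eq_a]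

theorem mem_Z_iff {i : Fin m} {j : J} : j ∈ Z i ↔ j ∈ K ∧ j ∉ O i := by
  rw [← h.union i, Finset.mem_union]
  have : j ∈ Z i → j ∉ O i := fun hj => Finset.disjoint_left.1 (h.disj i) hj
  tauto

theorem mem_O_iff {i : Fin m} {j : J} : j ∈ O i ↔ j ∈ K ∧ j ∉ Z i := by
  rw [← h.union i, Finset.mem_union]
  have : j ∈ Z i → j ∉ O i := fun hj => Finset.disjoint_left.1 (h.disj i) hj
  tauto

theorem mem_Z_of_succ {i : Fin m} {j : J} (hj : j ∈ Z (i + 1)) (hi : i ≠ p j) : j ∈ Z i := by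
  rw [h.mem_Z_iff] at hj ⊢
  exact ⟨hj.1, fun hO => hj.2 (h.mono i j hO hi)⟩

/-- Starting just after p_j, the next possible drop is a full turn away. Hence the columns with a
free initial value are those that lie in every O_i. -/
theorem mem_O_of_mem {j : J} (hj : j ∈ O (p j + 1)) (i : Fin m) : j ∈ O i :=
  cyclic_induction (p j) hj (fun i hi hm => h.mono i j hm hi) i

/-- Graph families are determined by the induced maps on the quotients, together with those columns
whose index always lies in `O_i`. -/
theorem graph_unique (hA : IsGraphFamily Z O d A) (hB : IsGraphFamily Z O d B)
    (hAB : ∀ i, quotMap Z d A i = quotMap Z d B i)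
    (hcol : ∀ j, j ∈ O (p j + 1) → ∀ z ∈ Z (p j + 1), A (p j + 1) z j = B (p j + 1) z j) :
    A = B := by
  have hPA := fun i => (quotMap_mul hA.1 h.disj h.union i).2 (hA.2 i)
  have hPB := fun i => (quotMap_mul hB.1 h.disj h.union i).2 (hB.2 i)
  have key : ∀ j i, (fun z => A i z j) = fun z => B i z j := by
    intro j
    refine cyclic_induction (p j) ?_ fun i hi hQ => ?_
    -- At p_j + 1 the column is prescribed if j ∈ O there, and otherwise vanishes by support.
    · funext z
      by_cases hz : z ∈ Z (p j + 1) ∧ j ∈ O (p j + 1)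
      · exact hcol j hz.2 z hz.1
      · rw [(hA.1 _).apply_eq_zero hz, (hB.1 _).apply_eq_zero hz]
    -- Away from p_j the scalar is 1, so Y_i P_i = P_{i+1} D_i computes column j at i + 1 from
    -- column j at i.
    · have e1 : ∀ {C : Fin m → Matrix J J R} (z : J),
          ((coordProj R (Z (i + 1)) - C (i + 1)) * Matrix.diagonal (d i)) z j =
            coordProj R (Z (i + 1)) z j - C (i + 1) z j := by
        intro C z
        rw [Matrix.mul_diagonal, h.eq_one j i hi, mul_one, Matrix.sub_apply]
      have e2 : (quotMap Z d A i * (coordProj R (Z i) - A i)).col j =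
          (quotMap Z d B i * (coordProj R (Z i) - B i)).col j := by
        rw [hAB]
        funext z
        simp only [Matrix.col_apply, Matrix.mul_apply, Matrix.sub_apply]
        refine Finset.sum_congr rfl fun w _ => ?_
        rw [congrFun hQ w]
      rw [hPA, hPB] at e2
      funext z
      have := congrFun e2 z
      rw [Matrix.col_apply, Matrix.col_apply, e1, e1] at this
      exact sub_right_injective this
  funext i
  ext z j
  exact congrFun (key j i) z

/-- Reconstruction of a graph family from the induced maps on the quotients. -/
theorem exists_graph {Y : Fin m → Matrix J J R}
    (hY : ∀ i, coordProj R (Z (i + 1)) * Y i = Y i) (hY' : ∀ i, Y i * coordProj R (Z i) = Y i)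
    (hYd : ∀ i, ∀ z ∈ Z i, z ∈ Z (i + 1) → (Y i).col z = d i z • Pi.single z 1)
    (hcyc : ∀ i, cyclicProd Y i * coordProj R (Z i) = a • coordProj R (Z i))
    (b : J → J → R) :
    ∃ A, IsGraphFamily Z O d A ∧ (∀ i, quotMap Z d A i = Y i) ∧
      ∀ j, j ∈ O (p j + 1) → ∀ z ∈ Z (p j + 1), A (p j + 1) z j = b j z := by
  -- The initial column of P = 1_Z - A at p_j + 1: it must be e_j when A has no column j there, and
  -- otherwise it is minus the prescribed column of A, cut down to the rows in Z.
  let v : J → J → R := fun j => if j ∈ Z (p j + 1) then Pi.single j 1 else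
    coordProj R (Z (p j + 1)) *ᵥ (-b j)
  have hv : ∀ j, coordProj R (Z (p j + 1)) *ᵥ v j = v j := by
    intro j
    by_cases hj : j ∈ Z (p j + 1)
    · simp only [v, if_pos hj]
      ext z
      rw [coordProj_mulVec_apply]
      by_cases hz : z = j
      · subst hz; simp [hj]
      · simp [hz]
    · simp only [v, if_neg hj, Matrix.mulVec_mulVec, coordProj_self_mul]
  have hc := fun j => exists_orbit (h.eq_a j) (h.eq_one j) (v := v j) (Y := Y) (by
    rw [← hv j, Matrix.mulVec_mulVec, hcyc, Matrix.smul_mulVec])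
  choose c hc0 hc using hc
  have hcZ : ∀ j i, coordProj R (Z i) *ᵥ c j i = c j i := by
    intro j
    refine cyclic_induction (p j) (by rw [hc0, hv]) fun i hi _ => ?_
    have := hc j i
    rw [h.eq_one j i hi, one_smul] at this
    rw [← this, Matrix.mulVec_mulVec, hY]
  -- This is what makes A = 1_Z - P vanish on the columns in Z_i. Membership in Z at i + 1 forces
  -- membership at i except at p_j, and `hYd` says that Y_i then fixes e_j.
  have hce : ∀ j i, j ∈ Z i → c j i = Pi.single j 1 := by
    intro j
    refine cyclic_induction (p j) (fun hj => ?_) fun i hi hQ hj => ?_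
    · rw [hc0]
      simp only [v, if_pos hj]
    · have hj' := h.mem_Z_of_succ hj hi
      have := hc j i
      rw [h.eq_one j i hi, one_smul, hQ hj'] at this
      rw [← this, Matrix.mulVec_single_one, hYd i j hj' hj, h.eq_one j i hi, one_smul]
  -- The orbits exist for every j, but only the columns in K belong to the family.
  let P : Fin m → Matrix J J R := fun i => Matrix.of fun z j => if j ∈ K then c j i z else 0
  have hPcol : ∀ i j, j ∈ K → (P i).col j = c j i := by
    intro i j hj
    ext z
    simp [P, hj]
  have hPcol' : ∀ i j, j ∉ K → (P i).col j = 0 := by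
    intro i j hj
    ext z
    simp [P, hj]
  have hZK : ∀ {i j}, j ∈ Z i → j ∈ K := fun hj => (h.mem_Z_iff.1 hj).1
  have hcolmul : ∀ (M N : Matrix J J R) j, (M * N).col j = M *ᵥ N.col j := by
    intro M N j
    ext z
    simp [Matrix.mul_apply, Matrix.mulVec, dotProduct]
  have hext : ∀ {M N : Matrix J J R}, (∀ j, M.col j = N.col j) → M = N := by
    intro M N hMN
    ext z j
    exact congrFun (hMN j) z
  have hZP : ∀ i, coordProj R (Z i) * P i = P i := by
    refine fun i => hext fun j => ?_
    rw [hcolmul]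
    by_cases hj : j ∈ K
    · rw [hPcol i j hj, hcZ]
    · rw [hPcol' i j hj, Matrix.mulVec_zero]
  have hPZ : ∀ i, P i * coordProj R (Z i) = coordProj R (Z i) := by
    intro i
    ext z j
    rw [mul_coordProj_apply, coordProj_apply]
    by_cases hj : j ∈ Z i
    · have := congrFun (hPcol i j (hZK hj)) z
      rw [hce j i hj] at this
      rw [if_pos hj]
      refine this.trans ?_
      simp [Pi.single_apply, hj]
    · simp [hj]
  have hPK : ∀ i, P i * coordProj R K = P i := by
    intro i
    ext z j
    rw [mul_coordProj_apply]
    by_cases hj : j ∈ K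
    · simp [hj]
    · have := congrFun (hPcol' i j hj) z
      rw [if_neg hj]
      exact this.symm
  let A : Fin m → Matrix J J R := fun i => coordProj R (Z i) - P i
  have hPA : ∀ i, coordProj R (Z i) - A i = P i := fun i => sub_sub_cancel _ _
  have hA : ∀ i, IsSupported (Z i) (O i) (A i) := by
    intro i
    have h0 : A i * coordProj R (Z i) = 0 := by
      rw [Matrix.sub_mul, hPZ, coordProj_self_mul, sub_self]
    have h1 : A i * coordProj R K = A i := by
      rw [Matrix.sub_mul, hPK, coordProj_mul_coordProj, ← h.union i, Finset.inter_eq_left.2]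
      exact Finset.subset_union_left
    refine ⟨?_, ?_⟩
    · rw [Matrix.mul_sub, hZP, coordProj_self_mul]
    · rw [← h.union i, coordProj_union (h.disj i), Matrix.mul_add, h0, zero_add] at h1
      exact h1
  have hrel : ∀ i, Y i * P i = P (i + 1) * Matrix.diagonal (d i) := by
    refine fun i => hext fun j => ?_
    have hd : (P (i + 1) * Matrix.diagonal (d i)).col j = d i j • (P (i + 1)).col j := by
      ext z
      simp [Matrix.mul_diagonal, mul_comm]
    rw [hcolmul, hd]
    by_cases hj : j ∈ K
    · rw [hPcol i j hj, hPcol _ j hj, hc]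
    · rw [hPcol' i j hj, hPcol' _ j hj, Matrix.mulVec_zero, smul_zero]
  have hquot : ∀ i, quotMap Z d A i = Y i := by
    intro i
    rw [quotMap, hPA, ← hrel, Matrix.mul_assoc, hPZ, hY']
  refine ⟨A, ⟨hA, fun i => ?_⟩, hquot, fun j hj z hz => ?_⟩
  · rw [← quotMap_mul hA h.disj h.union, hquot, hPA, hPA, hrel]
  · have hjK := (h.mem_O_iff.1 hj).1
    have hjZ := (h.mem_O_iff.1 hj).2
    have h1 : P (p j + 1) z j = v j z := by
      rw [← hc0 j]
      exact congrFun (hPcol _ j hjK) z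
    have hzj : z ≠ j := by rintro rfl; exact hjZ hz
    simp only [A, Matrix.sub_apply, h1, v, if_neg hjZ, coordProj_mulVec_apply, if_pos hz,
      coordProj_apply, hzj, false_and, if_false, Pi.neg_apply, zero_sub, neg_neg]

end IsDropData

/-- Removal of rows: `S` consists of indices which lie in no `O_i`. -/
theorem isGraphFamily_union_iff {S : Finset J} (hZO : ∀ i, Disjoint (Z i) (O i))
    (hK : ∀ i, Z i ∪ O i = K) (hS : Disjoint K S) (hA : ∀ i, IsSupported (Z i ∪ S) (O i) (A i)) :
    IsGraphFamily (fun i => Z i ∪ S) O d A ↔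
      IsGraphFamily Z O d (fun i => coordProj R (Z i) * A i) ∧
        ∀ k ∈ S, ∀ i, (A (i + 1)).row k ᵥ* subMap O d (fun i => coordProj R (Z i) * A i) i =
          d i k • (A i).row k := by
  have hZK : ∀ i, Z i ⊆ K := fun i => hK i ▸ Finset.subset_union_left
  have hOK : ∀ i, O i ⊆ K := fun i => hK i ▸ Finset.subset_union_right
  have hSO : ∀ i, Disjoint S (O i) := fun i =>
    (hS.mono_left (hOK i)).symm
  have hZO' : ∀ i, Disjoint (Z i ∪ S) (O i) := fun i =>
    Finset.disjoint_union_left.2 ⟨hZO i, hSO i⟩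
  have hK' : ∀ i, Z i ∪ S ∪ O i = K ∪ S := fun i => by
    rw [Finset.union_right_comm, hK]
  have hA' : ∀ i, IsSupported (Z i) (O i) (coordProj R (Z i) * A i) := fun i =>
    ⟨by rw [← Matrix.mul_assoc, coordProj_self_mul], by rw [Matrix.mul_assoc, (hA i).2]⟩
  -- The map induced on the graphs only sees rows in O_{i+1}, which S avoids. So the rows in S do
  -- not occur in it, and their equations are linear over the reduced family.
  have hsub : ∀ i, subMap O d (fun i => coordProj R (Z i) * A i) i = subMap O d A i := by
    intro i
    ext z j
    rw [subMap, subMap, Matrix.mul_assoc, Matrix.mul_assoc, coordProj_mul_apply,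
      coordProj_mul_apply]
    by_cases hz : z ∈ O (i + 1)
    · rw [if_pos hz, if_pos hz, Matrix.diagonal_mul, Matrix.diagonal_mul, Matrix.add_apply,
        Matrix.add_apply, coordProj_mul_apply]
      by_cases hzZ : z ∈ Z i
      · rw [if_pos hzZ]
      · rw [if_neg hzZ, (hA i).apply_eq_zero fun hzj => ?_]
        rcases Finset.mem_union.1 hzj.1 with h1 | h1
        · exact hzZ h1
        · exact Finset.disjoint_left.1 (hSO (i + 1)) h1 hz
    · rw [if_neg hz, if_neg hz]
  -- Since the diagonal matrix acts on the left, the criterion of `mul_subMap` splits into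
  -- independent equations for each row: the rows outside S give the reduced family, those in S the
  -- extra condition.
  have hrow : ∀ {B C : Fin m → Matrix J J R}, (∀ i, (coordProj R (O (i + 1)) + B (i + 1)) * C i =
      Matrix.diagonal (d i) * (coordProj R (O i) + B i)) ↔ ∀ k i,
      (coordProj R (O (i + 1)) + B (i + 1)).row k ᵥ* C i =
        d i k • (coordProj R (O i) + B i).row k := by
    intro B C
    constructor
    · intro H k i
      ext j
      have := congrFun (congrFun (H i) k) j
      rw [Matrix.diagonal_mul] at this
      exact this
    · intro H i
      ext k j
      rw [Matrix.diagonal_mul]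
      exact congrFun (H k i) j
  have e1 : IsGraphFamily (fun i => Z i ∪ S) O d A ↔ ∀ k i,
      (coordProj R (O (i + 1)) + A (i + 1)).row k ᵥ* subMap O d A i =
        d i k • (coordProj R (O i) + A i).row k := by
    rw [← hrow, IsGraphFamily, and_iff_right hA]
    exact forall_congr' fun i => (mul_subMap hA hZO' hK' i).symm
  have e2 : IsGraphFamily Z O d (fun i => coordProj R (Z i) * A i) ↔ ∀ k i,
      (coordProj R (O (i + 1)) + coordProj R (Z (i + 1)) * A (i + 1)).row k ᵥ* subMap O d A i =
        d i k • (coordProj R (O i) + coordProj R (Z i) * A i).row k := by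
    rw [← hrow (B := fun i => coordProj R (Z i) * A i), IsGraphFamily, and_iff_right hA']
    simp only [← hsub]
    exact forall_congr' fun i => (mul_subMap hA' hZO hK i).symm
  have r1 : ∀ k ∈ S, ∀ i, (coordProj R (O i) + A i).row k = (A i).row k := by
    intro k hk i
    ext j
    rw [Matrix.row_apply, Matrix.row_apply, Matrix.add_apply, coordProj_apply, if_neg, zero_add]
    rintro ⟨rfl, hj⟩
    exact Finset.disjoint_left.1 (hSO i) hk hj
  have r2 : ∀ k ∈ S, ∀ i, (coordProj R (O i) + coordProj R (Z i) * A i).row k = 0 := by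
    intro k hk i
    ext j
    rw [Matrix.row_apply, Matrix.add_apply, coordProj_apply, if_neg, zero_add,
      coordProj_mul_apply, if_neg, Pi.zero_apply]
    · exact fun hkZ => Finset.disjoint_left.1 hS (hZK i hkZ) hk
    · rintro ⟨rfl, hj⟩
      exact Finset.disjoint_left.1 (hSO i) hk hj
  have r3 : ∀ k ∉ S, ∀ i, (coordProj R (O i) + coordProj R (Z i) * A i).row k =
      (coordProj R (O i) + A i).row k := by
    intro k hk i
    ext j
    rw [Matrix.row_apply, Matrix.row_apply, Matrix.add_apply, Matrix.add_apply,
      coordProj_mul_apply]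
    by_cases hkZ : k ∈ Z i
    · rw [if_pos hkZ]
    · rw [if_neg hkZ, (hA i).apply_eq_zero]
      rintro ⟨h1, -⟩
      exact (Finset.mem_union.1 h1).elim hkZ hk
  rw [e1, e2]
  simp only [hsub]
  constructor
  · intro H
    refine ⟨fun k i => ?_, fun k hk i => ?_⟩
    · by_cases hk : k ∈ S
      · rw [r2 k hk, r2 k hk, Matrix.zero_vecMul, smul_zero]
      · rw [r3 k hk, r3 k hk, H]
    · rw [← r1 k hk, ← r1 k hk, H]
  · rintro ⟨H1, H2⟩ k i
    by_cases hk : k ∈ S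
    · rw [r1 k hk, r1 k hk, H2 k hk]
    · rw [← r3 k hk, ← r3 k hk, H1]

end reconstruct

/-! ### Passage to N × N matrices, and the free rows and columns -/

section coordinates

variable {R : Type*} [CommRing R] {J : Type*} [Fintype J] [DecidableEq J] {m N : ℕ} [NeZero m]

/-- The inclusion `R ^ N → R ^ J` of the coordinates enumerated by `f`. -/
def coordIncl (R : Type*) [CommRing R] (f : Fin N → J) : Matrix J (Fin N) R :=
  Matrix.of fun j μ => if f μ = j then 1 else 0

theorem mul_coordIncl_apply {I : Type*} (M : Matrix I J R) (f : Fin N → J) (i : I) (μ : Fin N) :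
    (M * coordIncl R f) i μ = M i (f μ) := by
  simp [coordIncl, Matrix.mul_apply]

theorem coordIncl_transpose_mul_apply {I : Type*} (M : Matrix J I R) (f : Fin N → J) (μ : Fin N)
    (i : I) : ((coordIncl R f)ᵀ * M) μ i = M (f μ) i := by
  simp [coordIncl, Matrix.mul_apply]

theorem coordIncl_transpose_mul_self {f : Fin N → J} (hf : Function.Injective f) :
    (coordIncl R f)ᵀ * coordIncl R f = 1 := by
  ext μ ν
  rw [coordIncl_transpose_mul_apply]
  simp [coordIncl, Matrix.one_apply, hf.eq_iff, eq_comm]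

theorem coordIncl_mul_transpose {f : Fin N → J} (hf : Function.Injective f) {Z : Finset J}
    (hZ : ∀ j, j ∈ Z ↔ ∃ μ, f μ = j) :
    coordIncl R f * (coordIncl R f)ᵀ = coordProj R Z := by
  ext i j
  rw [coordProj_apply]
  simp only [coordIncl, Matrix.mul_apply, Matrix.transpose_apply, Matrix.of_apply, ite_mul,
    one_mul, zero_mul]
  split_ifs with h
  · obtain ⟨rfl, hi⟩ := h
    obtain ⟨μ, rfl⟩ := (hZ _).1 hi
    simp [hf.eq_iff]
  · refine Finset.sum_eq_zero fun μ _ => ?_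
    split_ifs with h1 h2
    · exact absurd ⟨h1.symm.trans h2, (hZ _).2 ⟨μ, h2⟩⟩ h
    · rfl
    · rfl

theorem coordProj_mul_coordIncl {f : Fin N → J} {Z : Finset J}
    (hZ : ∀ j, j ∈ Z ↔ ∃ μ, f μ = j) : coordProj R Z * coordIncl R f = coordIncl R f := by
  ext j μ
  rw [coordProj_mul_apply]
  split_ifs with h
  · rfl
  · simp only [coordIncl, Matrix.of_apply]
    rw [if_neg]
    rintro rfl
    exact h ((hZ _).2 ⟨μ, rfl⟩)

theorem coordIncl_transpose_mul_coordProj {f : Fin N → J} {Z : Finset J}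
    (hZ : ∀ j, j ∈ Z ↔ ∃ μ, f μ = j) : (coordIncl R f)ᵀ * coordProj R Z = (coordIncl R f)ᵀ := by
  have := congrArg Matrix.transpose (coordProj_mul_coordIncl (R := R) hZ)
  rwa [Matrix.transpose_mul, coordProj, Matrix.diagonal_transpose] at this

/-- The tuples `(X_i) ∈ ∏ 𝔛_i` all of whose cyclic products are `a`, where `f i` enumerates the labels
of rows and columns at `i`. -/
def IsCyclicTuple (a : R) (Z : Fin m → Finset J) (d : Fin m → J → R) (f : Fin m → Fin N → J)
    (X : Fin m → Matrix (Fin N) (Fin N) R) : Prop :=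
  (∀ i μ ι, f i ι ∈ Z (i + 1) →
    X i μ ι = if f (i + 1) μ = f i ι then d i (f i ι) else 0) ∧
  ∀ i, cyclicProd X i = a • 1

/-- The matrix of the map induced on the quotients by the graphs, in the enumeration `f`. -/
def quotMatrix (Z : Fin m → Finset J) (d : Fin m → J → R) (f : Fin m → Fin N → J)
    (A : Fin m → Matrix J J R) (i : Fin m) : Matrix (Fin N) (Fin N) R :=
  Matrix.of fun μ ν => (coordProj R (Z (i + 1)) (f (i + 1) μ) (f i ν) -
    A (i + 1) (f (i + 1) μ) (f i ν)) * d i (f i ν)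

variable {a : R} {Z O : Fin m → Finset J} {K : Finset J} {d : Fin m → J → R} {p : J → Fin m}
  {A B : Fin m → Matrix J J R} {f : Fin m → Fin N → J}

theorem quotMatrix_eq (hZ : ∀ i j, j ∈ Z i ↔ ∃ μ, f i μ = j) (i : Fin m) :
    quotMatrix Z d f A i = (coordIncl R (f (i + 1)))ᵀ *
      quotMap Z d (fun i => coordProj R (Z i) * A i) i * coordIncl R (f i) := by
  ext μ ν
  rw [mul_coordIncl_apply, coordIncl_transpose_mul_apply, quotMap, mul_coordProj_apply,
    if_pos ((hZ _ _).2 ⟨ν, rfl⟩), Matrix.mul_diagonal, Matrix.sub_apply, coordProj_mul_apply,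
    if_pos ((hZ _ _).2 ⟨μ, rfl⟩)]
  rfl

theorem coordProj_mul_quotMap (hA : ∀ i, IsSupported (Z i) (O i) (A i)) (i : Fin m) :
    coordProj R (Z (i + 1)) * quotMap Z d A i = quotMap Z d A i := by
  rw [quotMap, ← Matrix.mul_assoc, ← Matrix.mul_assoc, coordProj_mul_sub (hA _)]

namespace IsDropData

variable (h : IsDropData a Z O K d p)
include h

/-- A label in Z_{i+1} is not a column of A_{i+1}, so only the scalar d_i survives in that column of
X_i. The product equations come from `cyclicProd_quotMap` through the coordinate inclusions, which
intertwine the two tuples. -/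
theorem isCyclicTuple_quotMatrix (hf : ∀ i, Function.Injective (f i))
    (hZ : ∀ i j, j ∈ Z i ↔ ∃ μ, f i μ = j)
    (hA : IsGraphFamily Z O d fun i => coordProj R (Z i) * A i)
    (hAs : ∀ i z j, A i z j ≠ 0 → j ∈ O i) :
    IsCyclicTuple a Z d f (quotMatrix Z d f A) := by
  refine ⟨fun i μ ι hι => ?_, fun i => ?_⟩
  · have h0 : A (i + 1) (f (i + 1) μ) (f i ι) = 0 := by
      by_contra h0
      exact Finset.disjoint_left.1 (h.disj (i + 1)) hι (hAs _ _ _ h0)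
    simp only [quotMatrix, Matrix.of_apply, h0, sub_zero, coordProj_apply]
    by_cases hμ : f (i + 1) μ = f i ι <;> simp [hμ, hι]
  · have h1 := cyclicProd_intertwine (Y := quotMap Z d fun i => coordProj R (Z i) * A i)
      (X := quotMatrix Z d f A) (U := fun i => coordIncl R (f i)) (fun i => by
        rw [quotMatrix_eq hZ, ← Matrix.mul_assoc, ← Matrix.mul_assoc,
          coordIncl_mul_transpose (hf _) (hZ _), coordProj_mul_quotMap hA.1]) i
    have h2 := congrArg (· * coordIncl R (f i)) (cyclicProd_quotMap hA h.disj h.union h.prod_eq i)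
    simp only [Matrix.mul_assoc, Matrix.smul_mul, coordProj_mul_coordIncl (hZ i)] at h2
    rw [h1] at h2
    have h3 := congrArg ((coordIncl R (f i))ᵀ * ·) h2
    simpa only [← Matrix.mul_assoc, coordIncl_transpose_mul_self (hf i), Matrix.one_mul,
      Matrix.mul_smul] using h3

theorem graph_unique_of_quotMatrix (hf : ∀ i, Function.Injective (f i))
    (hZ : ∀ i j, j ∈ Z i ↔ ∃ μ, f i μ = j)
    (hA : IsGraphFamily Z O d fun i => coordProj R (Z i) * A i)
    (hB : IsGraphFamily Z O d fun i => coordProj R (Z i) * B i)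
    (hAB : quotMatrix Z d f A = quotMatrix Z d f B)
    (hcol : ∀ j, j ∈ O (p j + 1) → ∀ μ, A (p j + 1) (f (p j + 1) μ) j = B (p j + 1) (f (p j + 1) μ) j) :
    (fun i => coordProj R (Z i) * A i) = fun i => coordProj R (Z i) * B i := by
  have hq : ∀ {C : Fin m → Matrix J J R}, IsGraphFamily Z O d (fun i => coordProj R (Z i) * C i) →
      ∀ i, quotMap Z d (fun i => coordProj R (Z i) * C i) i =
        coordIncl R (f (i + 1)) * quotMatrix Z d f C i * (coordIncl R (f i))ᵀ := by
    intro C hC i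
    rw [quotMatrix_eq hZ, ← Matrix.mul_assoc, ← Matrix.mul_assoc,
      coordIncl_mul_transpose (hf _) (hZ _), coordProj_mul_quotMap hC.1, Matrix.mul_assoc,
      coordIncl_mul_transpose (hf _) (hZ _), quotMap,
      Matrix.mul_assoc _ (coordProj R (Z i)), coordProj_self_mul]
  refine h.graph_unique hA hB (fun i => by rw [hq hA, hq hB, hAB]) fun j hj z hz => ?_
  obtain ⟨μ, rfl⟩ := (hZ _ _).1 hz
  rw [coordProj_mul_apply, coordProj_mul_apply, if_pos hz, if_pos hz, hcol j hj]

/-- Extending X_i by zero to a J × J matrix turns the equations of W into the hypotheses of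
`exists_graph`: the prescribed columns become `hYd`, the cyclic products become `hcyc`. -/
theorem exists_graph_of_cyclicTuple (hf : ∀ i, Function.Injective (f i))
    (hZ : ∀ i j, j ∈ Z i ↔ ∃ μ, f i μ = j) {X : Fin m → Matrix (Fin N) (Fin N) R}
    (hX : IsCyclicTuple a Z d f X) (b : J → Fin N → R) :
    ∃ A, IsGraphFamily Z O d A ∧ quotMatrix Z d f A = X ∧
      ∀ j, j ∈ O (p j + 1) → ∀ μ, A (p j + 1) (f (p j + 1) μ) j = b j μ := by
  set Y : Fin m → Matrix J J R := fun i =>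
    coordIncl R (f (i + 1)) * X i * (coordIncl R (f i))ᵀ with hYdef
  have hYU : ∀ i, Y i * coordIncl R (f i) = coordIncl R (f (i + 1)) * X i := fun i => by
    rw [hYdef, Matrix.mul_assoc, coordIncl_transpose_mul_self (hf i), Matrix.mul_one]
  obtain ⟨A, hA, hAY, hAb⟩ := h.exists_graph (Y := Y)
    (fun i => by
      rw [hYdef, ← Matrix.mul_assoc, ← Matrix.mul_assoc, coordProj_mul_coordIncl (hZ _)])
    (fun i => by
      rw [hYdef, Matrix.mul_assoc, coordIncl_transpose_mul_coordProj (hZ _)])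
    (fun i z hz hz' => by
      obtain ⟨ι, rfl⟩ := (hZ i z).1 hz
      ext w
      have e1 : (Y i) w (f i ι) = (coordIncl R (f (i + 1)) * X i) w ι := by
        rw [← hYU, mul_coordIncl_apply]
      rw [Matrix.col_apply, e1, Matrix.mul_apply]
      simp only [hX.1 i _ ι hz', coordIncl, Matrix.of_apply, Pi.smul_apply, smul_eq_mul]
      by_cases hw : w = f i ι
      · subst hw
        obtain ⟨ι', hι'⟩ := (hZ _ _).1 hz'
        rw [Finset.sum_eq_single ι']
        · simp [hι']
        · intro μ _ hμ
          rw [if_neg, zero_mul]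
          exact fun h' => hμ (hf _ (h'.trans hι'.symm))
        · simp
      · rw [Pi.single_eq_of_ne hw, mul_zero]
        refine Finset.sum_eq_zero fun μ _ => ?_
        split_ifs with h1 h2
        · exact absurd (h1.symm.trans h2) hw
        all_goals simp)
    (fun i => by
      rw [← coordIncl_mul_transpose (hf i) (hZ i), ← Matrix.mul_assoc,
        cyclicProd_intertwine (U := fun i => coordIncl R (f i)) hYU i, hX.2 i, Matrix.mul_smul,
        Matrix.mul_one, Matrix.smul_mul])
    (fun j => coordIncl R (f (p j + 1)) *ᵥ b j)
  refine ⟨A, hA, ?_, fun j hj μ => ?_⟩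
  · funext i
    have hA' : (fun i => coordProj R (Z i) * A i) = A := funext fun i => (hA.1 i).1
    rw [quotMatrix_eq hZ, hA', hAY, Matrix.mul_assoc, hYU, ← Matrix.mul_assoc,
      coordIncl_transpose_mul_self (hf _), Matrix.one_mul]
  · rw [hAb j hj _ ((hZ _ _).2 ⟨μ, rfl⟩)]
    simp [Matrix.mulVec, dotProduct, coordIncl, (hf _).eq_iff]

/-- Graph families for `Z_i ∪ S`, where `S` consists of indices which lie in no `O_i`, correspond to
tuples of matrices `X_i` together with free parameters. -/
theorem existsUnique_graph (hf : ∀ i, Function.Injective (f i))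
    (hZ : ∀ i j, j ∈ Z i ↔ ∃ μ, f i μ = j) {S : Finset J} (hS : Disjoint K S)
    {X : Fin m → Matrix (Fin N) (Fin N) R}
    (hX : IsCyclicTuple a Z d f X) (u : J → J → R) (b : J → Fin N → R) :
    ∃! A, IsGraphFamily (fun i => Z i ∪ S) O d A ∧ quotMatrix Z d f A = X ∧
      (∀ k ∈ S, ∀ j ∈ O (p k), A (p k) k j = u k j) ∧
      ∀ j, j ∈ O (p j + 1) → ∀ μ, A (p j + 1) (f (p j + 1) μ) j = b j μ := by
  have hZK : ∀ i, Z i ⊆ K := fun i => h.union i ▸ Finset.subset_union_left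
  have hOK : ∀ i, O i ⊆ K := fun i => h.union i ▸ Finset.subset_union_right
  obtain ⟨A', hA', hAX, hAb⟩ := h.exists_graph_of_cyclicTuple hf hZ hX b
  have hL := cyclicProd_subMap hA' h.disj h.union h.prod_eq
  -- The row k is a backward orbit of the maps on the graphs, starting from the prescribed row at
  -- p_k cut down to O_{p_k}. The closing condition holds because the cyclic products of these maps
  -- are `a` as well.
  have hg := fun k => exists_orbit_row (h.eq_a k) (h.eq_one k) (Y := subMap O d A')
    (v := u k ᵥ* coordProj R (O (p k))) (by
      rw [Matrix.vecMul_vecMul, hL, Matrix.vecMul_smul])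
  choose g hg0 hg using hg
  have hLO : ∀ i, subMap O d A' i * coordProj R (O i) = subMap O d A' i := fun i => by
    rw [subMap, Matrix.mul_assoc, add_mul_coordProj (hA'.1 i)]
  have hgO : ∀ k i, g k i ᵥ* coordProj R (O i) = g k i := by
    intro k
    refine cyclic_induction_down (p k) ?_ fun i hi _ => ?_
    · rw [hg0, Matrix.vecMul_vecMul, coordProj_self_mul]
    · have := hg k i
      rw [h.eq_one k i hi, one_smul] at this
      rw [← this, Matrix.vecMul_vecMul, hLO]
  have hvec : ∀ (v : J → R) (s : Finset J) j, (v ᵥ* coordProj R s) j = if j ∈ s then v j else 0 := by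
    intro v s j
    simp [coordProj, Matrix.vecMul_diagonal]
  let A : Fin m → Matrix J J R := fun i => Matrix.of fun z j => if z ∈ S then g z i j else A' i z j
  have hAA' : ∀ i, coordProj R (Z i) * A i = A' i := by
    intro i
    ext z j
    rw [coordProj_mul_apply]
    split_ifs with hz
    · simp only [A, Matrix.of_apply]
      rw [if_neg (fun hzS => Finset.disjoint_left.1 hS (hZK i hz) hzS)]
    · rw [(hA'.1 i).apply_eq_zero fun hzj => hz hzj.1]
  have hAA'' : (fun i => coordProj R (Z i) * A i) = A' := funext hAA'
  have hAS : ∀ k ∈ S, ∀ i, (A i).row k = g k i := by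
    intro k hk i
    ext j
    simp [A, hk]
  have hAsupp : ∀ i, IsSupported (Z i ∪ S) (O i) (A i) := by
    intro i
    rw [isSupported_iff]
    intro z j hzj
    simp only [A, Matrix.of_apply] at hzj
    split_ifs at hzj with hz
    · refine ⟨Finset.mem_union_right _ hz, ?_⟩
      rw [← hgO, hvec] at hzj
      by_contra hj
      simp [hj] at hzj
    · have := isSupported_iff.1 (hA'.1 i) z j hzj
      exact ⟨Finset.mem_union_left _ this.1, this.2⟩
  have hAf : ∀ i μ j, A i (f i μ) j = A' i (f i μ) j := by
    intro i μ j
    have := congrFun (congrFun (hAA' i) (f i μ)) j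
    rwa [coordProj_mul_apply, if_pos ((hZ _ _).2 ⟨μ, rfl⟩)] at this
  refine ⟨A, ⟨?_, ?_, ?_, ?_⟩, ?_⟩
  · rw [isGraphFamily_union_iff h.disj h.union hS hAsupp, hAA'']
    refine ⟨hA', fun k hk i => ?_⟩
    rw [hAS k hk, hAS k hk, hg]
  · rw [← hAX]
    funext i
    ext μ ν
    simp only [quotMatrix, Matrix.of_apply, hAf]
  · intro k hk j hj
    have := congrFun (hAS k hk (p k)) j
    rw [hg0, hvec, if_pos hj] at this
    exact this
  · intro j hj μ
    rw [hAf, hAb j hj]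
  · rintro B ⟨hB, hBX, hBu, hBb⟩
    have hBs := hB.1
    rw [isGraphFamily_union_iff h.disj h.union hS hB.1] at hB
    have hBA : (fun i => coordProj R (Z i) * B i) = A' := by
      rw [← hAA'']
      refine h.graph_unique_of_quotMatrix hf hZ hB.1 (hAA''.symm ▸ hA') ?_ fun j hj μ => ?_
      · rw [hBX, ← hAX]
        funext i
        ext μ ν
        simp only [quotMatrix, Matrix.of_apply, hAf]
      · rw [hBb j hj, hAf, hAb j hj]
    -- Both families of rows obey the same recursion, as the reduced families agree; at p_k the
    -- entries are prescribed on O_{p_k} and zero elsewhere.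
    have hBrow : ∀ k ∈ S, ∀ i, (B i).row k = g k i := by
      intro k hk
      refine cyclic_induction_down (p k) ?_ fun i hi hQ => ?_
      · rw [hg0]
        ext j
        rw [hvec]
        split_ifs with hj
        · exact hBu k hk j hj
        · exact (hBs _).apply_eq_zero fun hzj => hj hzj.2
      · have h1 := hB.2 k hk i
        have h2 := hg k i
        rw [hBA, h.eq_one k i hi, one_smul, hQ] at h1
        rw [h.eq_one k i hi, one_smul] at h2
        rw [← h1, h2]
    funext i
    ext z j
    by_cases hz : z ∈ S
    · exact (congrFun (hBrow z hz i) j).trans (congrFun (hAS z hz i) j).symm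
    · by_cases hzZ : z ∈ Z i
      · have := congrFun (congrFun (congrFun (hBA.trans hAA''.symm) i) z) j
        rwa [coordProj_mul_apply, coordProj_mul_apply, if_pos hzZ, if_pos hzZ] at this
      · have hz' : ¬(z ∈ Z i ∪ S ∧ j ∈ O i) := fun hzj =>
          (Finset.mem_union.1 hzj.1).elim hzZ hz
        rw [(hBs i).apply_eq_zero hz', (hAsupp i).apply_eq_zero hz']

end IsDropData

end coordinates

/-! ### The graph of a matrix as a subsheaf -/

section mapping

variable {R R' : Type*} [CommRing R] [CommRing R'] {J : Type*} [Fintype J] [DecidableEq J]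

theorem coordProj_map (ρ : R →+* R') (s : Finset J) : (coordProj R s).map ρ = coordProj R' s := by
  ext i j
  rw [Matrix.map_apply, coordProj_apply, coordProj_apply]
  split_ifs <;> simp

theorem coordProj_sub_map (ρ : R →+* R') (s : Finset J) (A : Matrix J J R) :
    (coordProj R s - A).map ρ = coordProj R' s - A.map ρ := by
  rw [Matrix.map_sub _ (map_sub ρ), coordProj_map]

theorem coordProj_add_map (ρ : R →+* R') (s : Finset J) (A : Matrix J J R) :
    (coordProj R s + A).map ρ = coordProj R' s + A.map ρ := by
  rw [Matrix.map_add _ (map_add ρ), coordProj_map]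

theorem IsSupported.map {Z O : Finset J} {A : Matrix J J R} (h : IsSupported Z O A) (ρ : R →+* R') :
    IsSupported Z O (A.map ρ) := by
  rw [isSupported_iff] at h ⊢
  exact fun z j hzj => h z j fun h0 => hzj (by rw [Matrix.map_apply, h0, map_zero])

theorem IsSupported.sub_mulVec_eq_zero_iff {Z O : Finset J} (hK : Z ∪ O = Finset.univ)
    (hZO : Disjoint Z O) {A : Matrix J J R} {v : J → R} :
    (coordProj R Z - A) *ᵥ v = 0 ↔ (coordProj R O + A) *ᵥ v = v := by
  have h1 : (coordProj R Z - A) *ᵥ v + (coordProj R O + A) *ᵥ v = v := by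
    rw [← Matrix.add_mulVec, sub_add_add hZO, hK, coordProj_univ, Matrix.one_mulVec]
  constructor
  · intro h
    rwa [h, zero_add] at h1
  · intro h
    rwa [h, add_eq_right] at h1

/-- Factors the projection onto the graph through R^r, in the form B C with C B = 1 required by
`of_split`. -/
theorem add_factor {Z O : Finset J} {A : Matrix J J R} (hA : IsSupported Z O A)
    (hZO : Disjoint Z O) {r : ℕ} {o : Fin r → J} (ho : Function.Injective o)
    (hO : ∀ j, j ∈ O ↔ ∃ μ, o μ = j) :
    (coordIncl R o)ᵀ * ((coordProj R O + A) * coordIncl R o) = 1 ∧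
      (coordProj R O + A) * coordIncl R o * (coordIncl R o)ᵀ = coordProj R O + A := by
  constructor
  · rw [← coordIncl_transpose_mul_coordProj hO, Matrix.mul_assoc, ← Matrix.mul_assoc (coordProj R O),
      coordProj_mul_add hA hZO, coordProj_mul_coordIncl hO, coordIncl_transpose_mul_self ho]
  · rw [Matrix.mul_assoc, coordIncl_mul_transpose ho hO, add_mul_coordProj hA]

end mapping

section sheaf

variable {S : Scheme.{u}} {n : ℕ} {Z O : Finset (Fin n)}

theorem map_res_map_res {p q : ℕ} {V'' V' V : S.Opens} (h : V'' ≤ V') (h' : V' ≤ V)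
    (A : Matrix (Fin p) (Fin q) Γ(S, V)) :
    (A.map (res h')).map (res h) = A.map (res (h.trans h')) := by
  ext i j
  exact res_res h h' _

theorem map_res_self {p q : ℕ} {V : S.Opens} (h : V ≤ V) (A : Matrix (Fin p) (Fin q) Γ(S, V)) :
    A.map (res h) = A := by
  ext i j
  simp [res]

/-- The graph of `A`, for a matrix `A` of global functions with columns in `O` and rows in `Z`. -/
def graphSub (Z : Finset (Fin n)) (A : Matrix (Fin n) (Fin n) Γ(S, ⊤)) : Subsheaf S n :=
  kerSub ⊤ (coordProj _ Z - A)

theorem mem_graphSub {A : Matrix (Fin n) (Fin n) Γ(S, ⊤)} {V : S.Opens} {v : Fin n → Γ(S, V)} :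
    v ∈ (graphSub Z A).sec V ↔ (coordProj _ Z - A.map (res le_top)) *ᵥ v = 0 := by
  rw [graphSub, mem_kerSub_of_le le_top, coordProj_sub_map]

/-- Over `V`, the subsheaf `F` is the graph of `A`. -/
def IsGraphOn (Z : Finset (Fin n)) (F : Subsheaf S n) (V : S.Opens)
    (A : Matrix (Fin n) (Fin n) Γ(S, V)) : Prop :=
  ∀ (V' : S.Opens) (h : V' ≤ V) (v : Fin n → Γ(S, V')),
    v ∈ F.sec V' ↔ (coordProj _ Z - A.map (res h)) *ᵥ v = 0

theorem isGraphOn_graphSub (A : Matrix (Fin n) (Fin n) Γ(S, ⊤)) :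
    IsGraphOn Z (graphSub Z A) ⊤ A := fun _ _ _ => mem_graphSub

theorem IsGraphOn.res {F : Subsheaf S n} {V V' : S.Opens} {A : Matrix (Fin n) (Fin n) Γ(S, V)}
    (hF : IsGraphOn Z F V A) (h : V' ≤ V) : IsGraphOn Z F V' (A.map (res h)) := fun W hW v => by
  rw [hF W (hW.trans h), map_res_map_res]

theorem mulVec_eq_zero_of_forall {R : Type*} [CommRing R] {p q : ℕ} {M : Matrix (Fin p) (Fin q) R}
    (h : ∀ j, M *ᵥ Pi.single j 1 = 0) : M = 0 := by
  ext i j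
  have := congrFun (h j) i
  rwa [Matrix.mulVec_single_one] at this

/-- The columns of 1_O + B lie in F, so 1_Z - A kills them, and (1_Z - A)(1_O + B) = B - A. -/
theorem IsGraphOn.unique (hZO : Disjoint Z O) {F : Subsheaf S n}
    {V : S.Opens} {A B : Matrix (Fin n) (Fin n) Γ(S, V)} (hA : IsSupported Z O A)
    (hB : IsSupported Z O B) (hFA : IsGraphOn Z F V A) (hFB : IsGraphOn Z F V B) : A = B := by
  have h : (coordProj _ Z - A) * (coordProj _ O + B) = 0 := by
    refine mulVec_eq_zero_of_forall fun j => ?_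
    have h1 := (hFB V le_rfl ((coordProj _ O + B) *ᵥ Pi.single j 1)).2 (by
      rw [map_res_self, Matrix.mulVec_mulVec, sub_mul_add hB hB hZO, sub_self, Matrix.zero_mulVec])
    rw [hFA V le_rfl, map_res_self, Matrix.mulVec_mulVec] at h1
    exact h1
  rw [sub_mul_add hA hB hZO, sub_eq_zero] at h
  exact h.symm

theorem graphSub_isLocallyFree (hK : Z ∪ O = Finset.univ) (hZO : Disjoint Z O) {r : ℕ}
    (hr : O.card = r) {A : Matrix (Fin n) (Fin n) Γ(S, ⊤)} (hA : IsSupported Z O A) :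
    (graphSub Z A).IsLocallyFree r ∧ (graphSub Z A).IsLocallyDirectSummand := by
  refine of_split fun x => ⟨⊤, trivial, ?_⟩
  let o : Fin r → Fin n := fun k => (O.equivFinOfCardEq hr).symm k
  have ho : Function.Injective o := fun a b hab =>
    (O.equivFinOfCardEq hr).symm.injective (Subtype.ext hab)
  have hO : ∀ j, j ∈ O ↔ ∃ μ, o μ = j := fun j =>
    ⟨fun hj => ⟨O.equivFinOfCardEq hr ⟨j, hj⟩, by simp [o]⟩, by rintro ⟨μ, rfl⟩; simp [o]⟩
  obtain ⟨h1, h2⟩ := add_factor hA hZO ho hO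
  refine ⟨_, _, h1, fun V' h v => ?_⟩
  rw [h2, mem_graphSub, coordProj_add_map, IsSupported.sub_mulVec_eq_zero_iff hK hZO]

theorem graphSub_quotientGeneratedBy (hK : Z ∪ O = Finset.univ) (hZO : Disjoint Z O)
    {A : Matrix (Fin n) (Fin n) Γ(S, ⊤)} (hA : IsSupported Z O A) :
    (graphSub Z A).QuotientGeneratedBy {j | j ∈ Z} := by
  intro V
  rw [eq_top_iff]
  intro v _
  have h1 : v = (coordProj _ O + A.map (res le_top)) *ᵥ v +
      (coordProj _ Z - A.map (res le_top)) *ᵥ v := by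
    rw [← Matrix.add_mulVec, add_comm, sub_add_add hZO, hK, coordProj_univ, Matrix.one_mulVec]
  rw [h1]
  refine Submodule.add_mem _ (subset_generate _ _ (Or.inl ?_)) ?_
  · rw [SetLike.mem_coe, mem_graphSub, Matrix.mulVec_mulVec, sub_mul_add (hA.map _) (hA.map _) hZO,
      sub_self, Matrix.zero_mulVec]
  · rw [← coordProj_mul_sub (hA.map _), ← Matrix.mulVec_mulVec]
    set w := (coordProj _ Z - A.map (res (le_top : V ≤ ⊤))) *ᵥ v
    rw [pi_eq_sum_univ' (coordProj _ Z *ᵥ w)]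
    refine Submodule.sum_mem _ fun j _ => ?_
    rw [coordProj_mulVec_apply]
    split_ifs with hj
    · refine Submodule.smul_mem _ _ (subset_generate _ _ (Or.inr ⟨j, hj, ?_⟩))
      ext i
      simp [Pi.single_apply, eq_comm]
    · rw [zero_smul]
      exact Submodule.zero_mem _

/-- One inclusion pulls back the equations defining the graph. For the other, the graph of the
pulled back matrix is spanned by the columns of 1_O + A, which are pull-backs of global sections. -/
theorem graphSub_pullback {X Y : Scheme.{u}} (f : X ⟶ Y) (hK : Z ∪ O = Finset.univ)
    (hZO : Disjoint Z O) {A : Matrix (Fin n) (Fin n) Γ(Y, ⊤)} (hA : IsSupported Z O A) :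
    (graphSub Z A).pullback f = graphSub Z (A.map (pull f (le_top : ⊤ ≤ f ⁻¹ᵁ ⊤))) := by
  have hmap : ∀ {U : Y.Opens} {V : X.Opens} (h : V ≤ f ⁻¹ᵁ U),
      (A.map (res le_top)).map (pull f h) = (A.map (pull f (le_top : ⊤ ≤ f ⁻¹ᵁ ⊤))).map
        (res le_top) := by
    intro U V h
    ext i j
    exact (pull_res f _ _ _).trans (res_pull f _ _ _).symm
  ext1
  funext V
  apply le_antisymm
  · refine pullback_le _ _ _ (fun U V h w hw => ?_) V
    rw [mem_graphSub] at hw ⊢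
    have := congrArg (fun v => pull f h ∘ v) hw
    simp only [comp_mulVec, coordProj_sub_map, hmap] at this
    rw [this]
    ext
    simp
  · intro v hv
    rw [mem_graphSub, IsSupported.sub_mulVec_eq_zero_iff hK hZO] at hv
    rw [← hv, Matrix.mulVec_eq_sum]
    simp only [op_smul_eq_smul]
    refine Submodule.sum_mem _ fun j _ => Submodule.smul_mem _ _ ?_
    have h1 : (coordProj _ O + A) *ᵥ Pi.single j 1 ∈ (graphSub Z A).sec ⊤ := by
      rw [mem_graphSub, map_res_self, Matrix.mulVec_mulVec, sub_mul_add hA hA hZO, sub_self,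
        Matrix.zero_mulVec]
    have h2 := pull_mem_pullback f _ (le_top : V ≤ f ⁻¹ᵁ ⊤) h1
    convert h2 using 1
    rw [comp_mulVec, comp_single, coordProj_add_map, Matrix.mulVec_single_one]
    have := hmap (U := ⊤) (V := V) le_top
    rw [map_res_self] at this
    rw [this]
    rfl

theorem mapsInto_graphSub_iff {O' : Type u} [CommRing O'] {X : Over (Spec (.of O'))}
    {Z' O₁ : Finset (Fin n)}
    (hK : Z ∪ O₁ = Finset.univ) (hZO : Disjoint Z O₁) {M : Matrix (Fin n) (Fin n) O'}
    {A A' : Matrix (Fin n) (Fin n) Γ(X.left, ⊤)} (hA : IsSupported Z O₁ A) :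
    MapsInto X M (graphSub Z A) (graphSub Z' A') ↔
      (coordProj _ Z' - A') * M.map (scal X ⊤) * (coordProj _ O₁ + A) = 0 := by
  constructor
  · intro h
    refine mulVec_eq_zero_of_forall fun j => ?_
    have h1 := h ⊤ ((coordProj _ O₁ + A) *ᵥ Pi.single j 1) (by
      rw [mem_graphSub, map_res_self, Matrix.mulVec_mulVec, sub_mul_add hA hA hZO, sub_self,
        Matrix.zero_mulVec])
    rwa [mem_graphSub, map_res_self, Matrix.mulVec_mulVec, Matrix.mulVec_mulVec] at h1
  · intro h V v hv
    rw [mem_graphSub, IsSupported.sub_mulVec_eq_zero_iff hK hZO] at hv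
    rw [mem_graphSub, ← hv, Matrix.mulVec_mulVec, Matrix.mulVec_mulVec]
    have h1 := congrArg (fun B => B.map (res (le_top : V ≤ ⊤))) h
    have h2 : (M.map (scal X ⊤)).map (res (le_top : V ≤ ⊤)) = M.map (scal X V) := by
      ext i j
      exact res_scal X _ _
    simp only [Matrix.map_mul, coordProj_sub_map, coordProj_add_map, h2] at h1
    rw [h1, Matrix.map_zero _ (map_zero _), Matrix.zero_mulVec]

/-- The local sections that locally agree with a section of `F` in all coordinates outside `J`. -/
def localSup (F : Subsheaf S n) (J : Set (Fin n)) : Subsheaf S n where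
  sec V :=
    { carrier := {v | ∀ x ∈ V, ∃ (V' : S.Opens) (h : V' ≤ V), x ∈ V' ∧
        ∃ w ∈ F.sec V', ∀ j ∉ J, w j = res h (v j)}
      zero_mem' := fun x hx => ⟨V, le_rfl, hx, 0, Submodule.zero_mem _, by simp⟩
      add_mem' := fun {a b} ha hb x hx => by
        obtain ⟨V₁, h₁, hx₁, w₁, hw₁, e₁⟩ := ha x hx
        obtain ⟨V₂, h₂, hx₂, w₂, hw₂, e₂⟩ := hb x hx
        refine ⟨V₁ ⊓ V₂, inf_le_left.trans h₁, ⟨hx₁, hx₂⟩,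
          (res inf_le_left ∘ w₁) + (res inf_le_right ∘ w₂),
          Submodule.add_mem _ (F.res_mem _ _ hw₁) (F.res_mem _ _ hw₂), fun j hj => ?_⟩
        simp only [Pi.add_apply, Function.comp_apply, map_add, e₁ j hj, e₂ j hj, res_res]
      smul_mem' := fun c a ha x hx => by
        obtain ⟨V₁, h₁, hx₁, w₁, hw₁, e₁⟩ := ha x hx
        refine ⟨V₁, h₁, hx₁, res h₁ c • w₁, Submodule.smul_mem _ _ hw₁, fun j hj => ?_⟩
        simp [e₁ j hj] }
  res_mem {V' V} h v hv x hx := by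
    obtain ⟨V₁, h₁, hx₁, w₁, hw₁, e₁⟩ := hv x (h hx)
    refine ⟨V₁ ⊓ V', inf_le_right, ⟨hx₁, hx⟩, res inf_le_left ∘ w₁, F.res_mem _ _ hw₁,
      fun j hj => ?_⟩
    simp only [Function.comp_apply, e₁ j hj, res_res]
  mem_of_local V v hv x hx := by
    obtain ⟨V₁, h₁, hx₁, hv₁⟩ := hv x hx
    obtain ⟨V₂, h₂, hx₂, w, hw, e⟩ := hv₁ x hx₁
    refine ⟨V₂, h₂.trans h₁, hx₂, w, hw, fun j hj => ?_⟩
    rw [e j hj, Function.comp_apply, res_res]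

/-- `localSup F J` is a subsheaf containing F and the e_j with j ∈ J, hence is everything. Near x
each e_l therefore agrees outside J with a section of F, and finitely many neighbourhoods are
intersected. -/
theorem exists_section_of_quotientGeneratedBy {F : Subsheaf S n} {J : Set (Fin n)}
    (hF : F.QuotientGeneratedBy J) (x : S) (V : S.Opens) (hx : x ∈ V) :
    ∃ V' ≤ V, x ∈ V' ∧ ∀ l : Fin n, ∃ w ∈ F.sec V', ∀ j ∉ J, w j = (Pi.single l 1 : Fin n → _) j := by
  have h1 : ∀ l : Fin n, (Pi.single l 1 : Fin n → Γ(S, V)) ∈ (localSup F J).sec V := by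
    intro l
    refine generate_le (localSup F J) (fun U v hv => ?_) V (hF V ▸ Submodule.mem_top)
    rcases hv with hv | ⟨j, hj, rfl⟩
    · exact fun x hx => ⟨U, le_rfl, hx, v, hv, fun j _ => by simp [res]⟩
    · refine fun x hx => ⟨U, le_rfl, hx, 0, Submodule.zero_mem _, fun k hk => ?_⟩
      rw [Pi.single_eq_of_ne (by rintro rfl; exact hk hj), map_zero, Pi.zero_apply]
  have h2 : ∀ s : Finset (Fin n), ∃ V' ≤ V, x ∈ V' ∧ ∀ l ∈ s, ∃ w ∈ F.sec V',
      ∀ j ∉ J, w j = (Pi.single l 1 : Fin n → _) j := by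
    intro s
    induction s using Finset.induction_on with
    | empty => exact ⟨V, le_rfl, hx, by simp⟩
    | insert a s _ ih =>
      obtain ⟨V₁, h₁, hx₁, H₁⟩ := ih
      obtain ⟨V₂, h₂, hx₂, w₂, hw₂, e₂⟩ := h1 a x hx
      refine ⟨V₁ ⊓ V₂, inf_le_left.trans h₁, ⟨hx₁, hx₂⟩, fun l hl => ?_⟩
      rcases Finset.mem_insert.1 hl with rfl | hl
      · refine ⟨res inf_le_right ∘ w₂, F.res_mem _ _ hw₂, fun j hj => ?_⟩
        rw [Function.comp_apply, e₂ j hj, res_res]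
        exact congrFun (comp_single _ l) j
      · obtain ⟨w, hw, e⟩ := H₁ l hl
        refine ⟨res inf_le_left ∘ w, F.res_mem _ _ hw, fun j hj => ?_⟩
        rw [Function.comp_apply, e j hj]
        exact congrFun (comp_single _ l) j
  obtain ⟨V', h', hx', H⟩ := h2 Finset.univ
  exact ⟨V', h', hx', fun l => H l (Finset.mem_univ l)⟩

/-- Generation of the quotient makes the projection of F onto the coordinates in O surjective near
x. Both sides have rank r, so it is an isomorphism, and A is the remaining part of its inverse. -/
theorem exists_isGraphOn_local (hK : Z ∪ O = Finset.univ) (hZO : Disjoint Z O) {r : ℕ}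
    (hr : O.card = r) {F : Subsheaf S n} (hF : F.IsLocallyFree r ∧ F.IsLocallyDirectSummand)
    (hq : F.QuotientGeneratedBy {j | j ∈ Z}) (x : S) :
    ∃ V : S.Opens, x ∈ V ∧ ∃ A : Matrix (Fin n) (Fin n) Γ(S, V),
      IsSupported Z O A ∧ IsGraphOn Z F V A := by
  obtain ⟨V₀, hx₀, B, C, hCB, hchar⟩ := exists_split hF.1 hF.2 x
  obtain ⟨V, hV, hx, hw⟩ := exists_section_of_quotientGeneratedBy hq x V₀ hx₀
  choose w hwF hw using hw
  have hZO' : ∀ {j}, j ∈ O ↔ j ∉ Z := by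
    intro j
    have h1 : j ∈ Z ∪ O := hK ▸ Finset.mem_univ j
    have h2 : j ∈ Z → j ∉ O := fun h => Finset.disjoint_left.1 hZO h
    rw [Finset.mem_union] at h1
    tauto
  let o : Fin r → Fin n := fun k => (O.equivFinOfCardEq hr).symm k
  have ho : Function.Injective o := fun a b hab =>
    (O.equivFinOfCardEq hr).symm.injective (Subtype.ext hab)
  have hO : ∀ j, j ∈ O ↔ ∃ μ, o μ = j := fun j =>
    ⟨fun hj => ⟨O.equivFinOfCardEq hr ⟨j, hj⟩, by simp [o]⟩, by rintro ⟨μ, rfl⟩; simp [o]⟩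
  -- a section of `F` whose coordinates in `O` vanish is zero
  have hinj : ∀ (V' : S.Opens) (h : V' ≤ V) (v : Fin n → Γ(S, V')), v ∈ F.sec V' →
      (∀ j ∈ O, v j = 0) → v = 0 := by
    intro V' h v hv hv0
    let W : Matrix (Fin n) (Fin r) Γ(S, V) := Matrix.of fun i k => w (o k) i
    have h1 : (B * C).map (res hV) * W = W := by
      ext i k
      exact congrFun ((hchar V hV (w (o k))).1 (hwF (o k))) i
    have h2 : (coordIncl Γ(S, V) o)ᵀ * W = 1 := by
      ext k l
      rw [coordIncl_transpose_mul_apply]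
      have hk := hw (o l) (o k) (by
        simp only [Set.mem_ofPred_eq]
        exact hZO'.1 ((hO _).2 ⟨k, rfl⟩))
      simp only [W, Matrix.of_apply, hk, Matrix.one_apply, Pi.single_apply, ho.eq_iff]
    -- With E the inclusion of the O-coordinates, (Eᵀ B)(C W) = 1 for square r × r matrices. Hence
    -- also (C W)(Eᵀ B) = 1, so Eᵀ B, the projection of F to these coordinates in the basis B, is
    -- injective.
    rw [← h1, Matrix.map_mul, Matrix.mul_assoc, ← Matrix.mul_assoc,
      mul_eq_one_comm] at h2
    have h3 := congrArg (fun M => M.map (res h)) h2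
    simp only [Matrix.map_mul, map_res_map_res, Matrix.map_one _ (map_zero _) (map_one _)] at h3
    have h4 := (hchar V' (h.trans hV) v).1 hv
    rw [Matrix.map_mul, ← Matrix.mulVec_mulVec] at h4
    have h5 : ((coordIncl Γ(S, V) o)ᵀ).map (res h) *ᵥ v = 0 := by
      ext k
      have : (((coordIncl Γ(S, V) o)ᵀ).map (res h) *ᵥ v) k = v (o k) := by
        simp [Matrix.mulVec, dotProduct, coordIncl, apply_ite (res h)]
      rw [this, hv0 _ ((hO _).2 ⟨k, rfl⟩)]
      rfl
    rw [← h4, Matrix.mulVec_mulVec] at h5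
    have h6 : C.map (res (h.trans hV)) *ᵥ v = 0 := by
      have := congrArg (fun y => (C.map (res (h.trans hV)) * W.map (res h)) *ᵥ y) h5
      rwa [Matrix.mulVec_mulVec, h3, Matrix.one_mulVec, Matrix.mulVec_zero] at this
    rw [← h4, h6, Matrix.mulVec_zero]
  let A : Matrix (Fin n) (Fin n) Γ(S, V) := Matrix.of fun z l =>
    if z ∈ Z ∧ l ∈ O then w l z else 0
  have hA : IsSupported Z O A := isSupported_iff.2 fun z l hzl => by
    by_contra hcon
    exact hzl (if_neg hcon)
  have hcol : ∀ l ∈ O, (coordProj _ O + A) *ᵥ Pi.single l 1 = w l := by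
    intro l hl
    ext z
    rw [Matrix.mulVec_single_one, Matrix.col_apply, Matrix.add_apply, coordProj_apply]
    simp only [A, Matrix.of_apply, hl, and_true]
    by_cases hz : z ∈ Z
    · rw [if_neg (by rintro rfl; exact hZO'.1 hl hz), if_pos hz, zero_add]
    · rw [if_neg hz, hw l z hz, add_zero, Pi.single_apply]
  refine ⟨V, hx, A, hA, fun V' h v => ?_⟩
  have hG : ∀ u : Fin n → Γ(S, V'), (coordProj _ O + A.map (res h)) *ᵥ u ∈ F.sec V' := by
    intro u
    rw [← add_mul_coordProj (hA.map (res h)), ← Matrix.mulVec_mulVec, Matrix.mulVec_eq_sum]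
    simp only [op_smul_eq_smul]
    refine Submodule.sum_mem _ fun j _ => ?_
    rw [coordProj_mulVec_apply]
    split_ifs with hj
    · refine Submodule.smul_mem _ _ ?_
      have := F.res_mem h _ (hwF j)
      rw [← hcol j hj, comp_mulVec, comp_single, coordProj_add_map, Matrix.mulVec_single_one]
        at this
      exact this
    · rw [zero_smul]
      exact Submodule.zero_mem _
  rw [IsSupported.sub_mulVec_eq_zero_iff hK hZO]
  constructor
  · intro hv
    refine sub_eq_zero.1 (hinj V' h _ (Submodule.sub_mem _ (hG v) hv) fun j hj => ?_)
    have := congrFun (congrArg (fun M => M *ᵥ v) (coordProj_mul_add (hA.map (res h)) hZO)) j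
    simp only [← Matrix.mulVec_mulVec] at this
    rw [coordProj_mulVec_apply, coordProj_mulVec_apply, if_pos hj, if_pos hj] at this
    rw [Pi.sub_apply, this, sub_self]
  · intro hv
    rw [← hv]
    exact hG v

/-- The local matrices agree on overlaps by `IsGraphOn.unique`, so their entries glue to global
functions, and F is compared with the resulting graph locally. -/
theorem exists_eq_graphSub (hK : Z ∪ O = Finset.univ) (hZO : Disjoint Z O) {r : ℕ}
    (hr : O.card = r) {F : Subsheaf S n} (hF : F.IsLocallyFree r ∧ F.IsLocallyDirectSummand)
    (hq : F.QuotientGeneratedBy {j | j ∈ Z}) :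
    ∃ A : Matrix (Fin n) (Fin n) Γ(S, ⊤), IsSupported Z O A ∧ F = graphSub Z A := by
  have H := exists_isGraphOn_local hK hZO hr hF hq
  choose V hxV A hA hFA using H
  have hglue : ∀ z j, ∃ s : Γ(S, ⊤), ∀ x, res (le_top : V x ≤ ⊤) s = A x z j := by
    intro z j
    obtain ⟨s, hs, -⟩ := TopCat.Sheaf.existsUnique_gluing' S.sheaf V ⊤ (fun x => homOfLE le_top)
      (fun x _ => TopologicalSpace.Opens.mem_iSup.2 ⟨x, hxV x⟩) (fun x => A x z j) (by
        intro x y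
        have := ((hFA x).res (inf_le_left : V x ⊓ V y ≤ V x)).unique hZO ((hA x).map _)
          ((hA y).map _) ((hFA y).res (inf_le_right : V x ⊓ V y ≤ V y))
        exact congrFun (congrFun this z) j)
    exact ⟨s, hs⟩
  choose B hB using hglue
  have hBA : ∀ x, (Matrix.of B).map (res le_top) = A x := by
    intro x
    ext z j
    exact hB z j x
  have hBV : ∀ (U : S.Opens) (x : S), (A x).map (res (inf_le_right : U ⊓ V x ≤ V x)) =
      ((Matrix.of B).map (res (le_top : U ≤ ⊤))).map (res inf_le_left) := by
    intro U x
    rw [← hBA, map_res_map_res, map_res_map_res]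
  have hloc : ∀ (U : S.Opens) (v : Fin n → Γ(S, U)) (x : S),
      res (inf_le_left : U ⊓ V x ≤ U) ∘ v ∈ F.sec (U ⊓ V x) ↔
        res (inf_le_left : U ⊓ V x ≤ U) ∘
          ((coordProj _ Z - (Matrix.of B).map (res le_top)) *ᵥ v) = 0 := by
    intro U v x
    rw [hFA x _ inf_le_right, hBV, comp_mulVec, coordProj_sub_map]
  refine ⟨Matrix.of B, isSupported_iff.2 fun z j hzj => ?_, ?_⟩
  · by_contra hcon
    refine hzj ?_
    -- A single function is treated as a vector of length one.
    have := res_eq_zero_of_local (fun _ : Fin 1 => Matrix.of B z j) fun x _ => ⟨V x, le_top, hxV x, by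
      ext
      exact (hB z j x).trans ((hA x).apply_eq_zero hcon)⟩
    exact congrFun this 0
  · ext1
    funext U
    ext v
    rw [mem_graphSub]
    constructor
    · exact fun hv => res_eq_zero_of_local _ fun x hx =>
        ⟨U ⊓ V x, inf_le_left, ⟨hx, hxV x⟩, (hloc U v x).1 (F.res_mem _ _ hv)⟩
    · refine fun hv => F.mem_of_local U v fun x hx =>
        ⟨U ⊓ V x, inf_le_left, ⟨hx, hxV x⟩, (hloc U v x).2 ?_⟩
      rw [hv]
      ext
      simp

end sheaf

/-! ### Points of affine schemes -/

section affine

variable {X Y : Scheme.{u}} {Q Q' : Type u} [CommRing Q] [CommRing Q']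

theorem pull_eq_appTop {X Y : Scheme.{u}} (f : X ⟶ Y) (a : Γ(Y, ⊤)) :
    pull f (le_top : ⊤ ≤ f ⁻¹ᵁ ⊤) a = f.appTop.hom a := by
  exact (congrArg (fun g => g.hom a) (Scheme.Hom.app_eq_appLE (f := f) (U := ⊤))).symm

/-- The ring homomorphism that corresponds to a morphism to an affine scheme. -/
noncomputable def specPull (f : X ⟶ Spec (.of Q)) : Q →+* Γ(X, ⊤) :=
  (pull f (le_top : ⊤ ≤ f ⁻¹ᵁ ⊤)).comp (Scheme.ΓSpecIso (.of Q)).inv.hom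

theorem specPull_eq (f : X ⟶ Spec (.of Q)) :
    CommRingCat.ofHom (specPull f) = (Scheme.ΓSpecIso (.of Q)).inv ≫ f.appTop := by
  ext a
  exact pull_eq_appTop f _

theorem specPull_injective : Function.Injective (specPull : (X ⟶ Spec (.of Q)) → _) := by
  intro f g h
  have h1 := congrArg CommRingCat.ofHom h
  rw [specPull_eq, specPull_eq, Iso.cancel_iso_inv_left] at h1
  exact ext_of_isAffine h1

theorem specPull_comp (g : X ⟶ Y) (f : Y ⟶ Spec (.of Q)) :
    specPull (g ≫ f) = (pull g (le_top : ⊤ ≤ g ⁻¹ᵁ ⊤)).comp (specPull f) := by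
  ext a
  exact (pull_pull g f le_top le_top le_top _).symm

theorem specPull_comp_specMap (f : X ⟶ Spec (.of Q)) (φ : Q' →+* Q) :
    specPull (f ≫ Spec.map (CommRingCat.ofHom φ)) = (specPull f).comp φ := by
  refine congrArg CommRingCat.Hom.hom (?_ : CommRingCat.ofHom
    (specPull (f ≫ Spec.map (CommRingCat.ofHom φ))) = CommRingCat.ofHom ((specPull f).comp φ))
  rw [specPull_eq, Scheme.Hom.comp_appTop, CommRingCat.ofHom_comp, specPull_eq,
    ← Scheme.ΓSpecIso_inv_naturality_assoc]

theorem specPull_surjective : Function.Surjective (specPull : (X ⟶ Spec (.of Q)) → _) := by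
  intro h
  refine ⟨X.toSpecΓ ≫ Spec.map (CommRingCat.ofHom h), ?_⟩
  have h1 := specPull_comp_specMap (Q := Γ(X, ⊤)) X.toSpecΓ h
  refine h1.trans ?_
  have h2 : specPull (Q := Γ(X, ⊤)) X.toSpecΓ = RingHom.id _ := by
    refine congrArg CommRingCat.Hom.hom (?_ : CommRingCat.ofHom
      (specPull (Q := Γ(X, ⊤)) X.toSpecΓ) = CommRingCat.ofHom (RingHom.id Γ(X, ⊤)))
    rw [specPull_eq, Scheme.toSpecΓ_appTop]
    exact Iso.inv_hom_id _
  rw [h2, RingHom.id_comp]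

end affine

/-! ### Points of Z × 𝔸^d: a point of Z and d global functions -/

section timesAffineSpace

variable {O : Type u} [CommRing O] {Z X Y : Over (Spec (.of O))} {d : ℕ}

/-- The underlying scheme of `Z × 𝔸 ^ d`. -/
noncomputable abbrev timesScheme (Z : Over (Spec (.of O))) (d : ℕ) : Scheme.{u} :=
  Limits.pullback Z.hom (𝔸(ULift.{u} (Fin d); Spec (.of O)) ↘ Spec (.of O))

/-- The morphism of schemes that underlies a point of `Z × 𝔸 ^ d`. -/
noncomputable def timesLeft (f : X ⟶ timesAffineSpace Z d) : X.left ⟶ timesScheme Z d := f.left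

theorem timesLeft_w (f : X ⟶ timesAffineSpace Z d) :
    (timesLeft f ≫ Limits.pullback.fst _ _) ≫ Z.hom = X.hom := by
  rw [Category.assoc]
  exact Over.w f

/-- The projection of a point of `Z × 𝔸 ^ d` to `Z`. -/
noncomputable def affineBase (f : X ⟶ timesAffineSpace Z d) : X ⟶ Z :=
  Over.homMk (timesLeft f ≫ Limits.pullback.fst _ _) (timesLeft_w f)

/-- The coordinates of the projection of a point of `Z × 𝔸 ^ d` to `𝔸 ^ d`. -/
noncomputable def affineCoord (f : X ⟶ timesAffineSpace Z d) (k : Fin d) : Γ(X.left, ⊤) :=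
  pull (timesLeft f ≫ Limits.pullback.snd _ _) (le_top : ⊤ ≤ _ ⁻¹ᵁ ⊤) (AffineSpace.coord _ ⟨k⟩)

theorem timesAffineSpace_hom_ext {f g : X ⟶ timesAffineSpace Z d}
    (h1 : affineBase f = affineBase g) (h2 : affineCoord f = affineCoord g) : f = g := by
  have hleft : timesLeft f ≫ Limits.pullback.fst _ _ = timesLeft g ≫ Limits.pullback.fst _ _ :=
    congrArg (fun a => a.left) h1
  refine Over.OverMorphism.ext (?_ : timesLeft f = timesLeft g)
  refine Limits.pullback.hom_ext hleft (AffineSpace.hom_ext ?_ fun i => ?_)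
  · rw [Category.assoc, Category.assoc, ← Limits.pullback.condition, ← Category.assoc,
      ← Category.assoc, hleft]
  · have := congrFun h2 i.down
    rw [affineCoord, affineCoord, pull_eq_appTop, pull_eq_appTop] at this
    exact this

theorem exists_timesAffineSpace_hom (f : X ⟶ Z) (v : Fin d → Γ(X.left, ⊤)) :
    ∃ g : X ⟶ timesAffineSpace Z d, affineBase g = f ∧ affineCoord g = v := by
  let w : X.left ⟶ 𝔸(ULift.{u} (Fin d); Spec (.of O)) :=
    AffineSpace.homOfVector X.hom fun k => v k.down
  have hw : f.left ≫ Z.hom = w ≫ (𝔸(ULift.{u} (Fin d); Spec (.of O)) ↘ Spec (.of O)) := by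
    rw [AffineSpace.homOfVector_over, Over.w f]
  let l : X.left ⟶ timesScheme Z d := Limits.pullback.lift f.left w hw
  have hl : l ≫ (Limits.pullback.fst _ _ ≫ Z.hom) = X.hom := by
    rw [← Category.assoc, Limits.pullback.lift_fst, Over.w f]
  let g : X ⟶ timesAffineSpace Z d := Over.homMk l hl
  have hg : timesLeft g = l := rfl
  refine ⟨g, ?_, ?_⟩
  · refine Over.OverMorphism.ext (?_ : timesLeft g ≫ Limits.pullback.fst _ _ = f.left)
    rw [hg, Limits.pullback.lift_fst]
  · funext k
    rw [affineCoord, pull_eq_appTop, hg, Limits.pullback.lift_snd]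
    exact AffineSpace.homOfVector_appTop_coord _ _ _

theorem affineBase_comp (g : X ⟶ Y) (f : Y ⟶ timesAffineSpace Z d) :
    affineBase (g ≫ f) = g ≫ affineBase f :=
  Over.OverMorphism.ext (Category.assoc g.left (timesLeft f) _)

theorem affineCoord_comp (g : X ⟶ Y) (f : Y ⟶ timesAffineSpace Z d) (k : Fin d) :
    affineCoord (g ≫ f) k = pull g.left (le_top : ⊤ ≤ g.left ⁻¹ᵁ ⊤) (affineCoord f k) :=
  (pull_pull g.left (timesLeft f ≫ Limits.pullback.snd _ _) le_top le_top le_top _).symm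

end timesAffineSpace

/-! ### Points of a closed subscheme of affine space: solutions of its equations -/

section quotient

variable {O : Type u} [CommRing O] {σ : Type} {E : Set (MvPolynomial σ O)}
  {X Y : Over (Spec (.of O))}

/-- The closed subscheme of affine space defined by the equations `E`. -/
noncomputable def zeroScheme (E : Set (MvPolynomial σ O)) : Over (Spec (.of O)) :=
  Over.mk (Spec.map (CommRingCat.ofHom (algebraMap O (MvPolynomial σ O ⧸ Ideal.span E))))

/-- The coordinates of a point of `zeroScheme E`. -/
noncomputable def zeroCoord (f : X ⟶ zeroScheme E) (i : σ) : Γ(X.left, ⊤) :=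
  specPull (Q := MvPolynomial σ O ⧸ Ideal.span E) f.left (Ideal.Quotient.mk _ (MvPolynomial.X i))

theorem scal_eq_specPull : scal X ⊤ = specPull X.hom := rfl

/-- Being a morphism over Spec O fixes the ring homomorphism on constants, so it is evaluation at
the coordinates. -/
theorem specPull_comp_mk (f : X ⟶ zeroScheme E) :
    (specPull (Q := MvPolynomial σ O ⧸ Ideal.span E) f.left).comp (Ideal.Quotient.mk _) =
      MvPolynomial.eval₂Hom (scal X ⊤) (zeroCoord f) := by
  refine MvPolynomial.ringHom_ext (fun a => ?_) fun i => ?_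
  · rw [MvPolynomial.coe_eval₂Hom, MvPolynomial.eval₂_C, scal_eq_specPull, ← Over.w f]
    exact (congrFun (congrArg DFunLike.coe (specPull_comp_specMap
      (Q := MvPolynomial σ O ⧸ Ideal.span E) f.left (algebraMap O _))) a).symm
  · rw [MvPolynomial.coe_eval₂Hom, MvPolynomial.eval₂_X]
    rfl

theorem eval₂_zeroCoord (f : X ⟶ zeroScheme E) {p : MvPolynomial σ O} (hp : p ∈ E) :
    MvPolynomial.eval₂ (scal X ⊤) (zeroCoord f) p = 0 := by
  rw [← MvPolynomial.coe_eval₂Hom, ← specPull_comp_mk, RingHom.comp_apply,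
    Ideal.Quotient.eq_zero_iff_mem.2 (Ideal.subset_span hp), map_zero]

theorem zeroCoord_injective : Function.Injective (zeroCoord : (X ⟶ zeroScheme E) → _) := by
  intro f g h
  refine Over.OverMorphism.ext (specPull_injective (Q := MvPolynomial σ O ⧸ Ideal.span E) ?_)
  refine Ideal.Quotient.ringHom_ext ?_
  rw [specPull_comp_mk, specPull_comp_mk, h]

theorem exists_zeroCoord_eq (x : σ → Γ(X.left, ⊤))
    (hx : ∀ p ∈ E, MvPolynomial.eval₂ (scal X ⊤) x p = 0) :
    ∃ f : X ⟶ zeroScheme E, zeroCoord f = x := by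
  have hker : Ideal.span E ≤ RingHom.ker (MvPolynomial.eval₂Hom (scal X ⊤) x) :=
    Ideal.span_le.2 hx
  let h : MvPolynomial σ O ⧸ Ideal.span E →+* Γ(X.left, ⊤) :=
    Ideal.Quotient.lift _ (MvPolynomial.eval₂Hom (scal X ⊤) x) fun p hp => hker hp
  obtain ⟨f, hf⟩ := specPull_surjective h
  have hw : f ≫ (zeroScheme E).hom = X.hom := by
    refine specPull_injective ?_
    refine (specPull_comp_specMap f (algebraMap O _)).trans ?_
    rw [hf, ← scal_eq_specPull]
    ext a
    exact (Ideal.Quotient.lift_mk (Ideal.span E) (MvPolynomial.eval₂Hom (scal X ⊤) x) hker).trans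
      (MvPolynomial.eval₂_C (scal X ⊤) x a)
  refine ⟨Over.homMk f hw, funext fun i => ?_⟩
  refine (congrFun (congrArg DFunLike.coe hf) _).trans ?_
  exact (Ideal.Quotient.lift_mk _ _ _).trans (MvPolynomial.eval₂_X _ _ _)

theorem zeroCoord_comp (g : X ⟶ Y) (f : Y ⟶ zeroScheme E) (i : σ) :
    zeroCoord (g ≫ f) i = pull g.left (le_top : ⊤ ≤ g.left ⁻¹ᵁ ⊤) (zeroCoord f i) :=
  congrFun (congrArg DFunLike.coe (specPull_comp (Q := MvPolynomial σ O ⧸ Ideal.span E)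
    g.left f.left)) _

end quotient

/-! ### The chart as a functor of matrices -/

/-- The correspondence between points passes through a family of matrices known only by existence
and uniqueness, so a relation is more convenient than a pair of inverse maps. Uniqueness also yields
naturality. -/
theorem nonempty_iso_of_rel {C : Type v} [Category.{w} C] {F G : C ⥤ Type u}
    (Rel : ∀ X, F.obj X → G.obj X → Prop) (h1 : ∀ X x, ∃! y, Rel X x y)
    (h2 : ∀ X y, ∃! x, Rel X x y)
    (hnat : ∀ {X Y} (f : X ⟶ Y) x y, Rel X x y → Rel Y (F.map f x) (G.map f y)) :
    Nonempty (F ≅ G) := by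
  choose φ hφ hφ' using h1
  have hbij : ∀ X, Function.Bijective (φ X) := by
    intro X
    constructor
    · intro x x' hxx
      exact (h2 X (φ X x)).unique (hφ X x) (hxx ▸ hφ X x')
    · intro y
      obtain ⟨x, hx, -⟩ := h2 X y
      exact ⟨x, (hφ' X x y hx).symm⟩
  refine ⟨NatIso.ofComponents (fun X => (Equiv.ofBijective _ (hbij X)).toIso) fun {X Y} f => ?_⟩
  ext x
  exact (hφ' Y _ _ (hnat f x _ (hφ X x))).symm

section map

variable {R R' : Type*} [CommRing R] [CommRing R'] {J : Type*} [Fintype J] [DecidableEq J]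
  {m N : ℕ} [NeZero m] {Z O : Fin m → Finset J} {d : Fin m → J → R} {A : Fin m → Matrix J J R}

theorem diagonal_map_ringHom (ρ : R →+* R') (d : J → R) :
    (Matrix.diagonal d).map ρ = Matrix.diagonal fun j => ρ (d j) :=
  Matrix.diagonal_map (map_zero ρ)

theorem IsGraphFamily.map (h : IsGraphFamily Z O d A) (ρ : R →+* R') :
    IsGraphFamily Z O (fun i j => ρ (d i j)) fun i => (A i).map ρ := by
  refine ⟨fun i => (h.1 i).map ρ, fun i => ?_⟩
  have := congrArg (fun M => M.map ρ) (h.2 i)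
  simpa only [Matrix.map_mul, coordProj_sub_map, coordProj_add_map, diagonal_map_ringHom,
    Matrix.map_zero _ (map_zero ρ)] using this

theorem quotMatrix_map (f : Fin m → Fin N → J) (ρ : R →+* R') (i : Fin m) (μ ν : Fin N) :
    quotMatrix Z (fun i j => ρ (d i j)) f (fun i => (A i).map ρ) i μ ν =
      ρ (quotMatrix Z d f A i μ ν) := by
  have h := congrFun (congrFun (coordProj_map ρ (Z (i + 1))) (f (i + 1) μ)) (f i ν)
  simp only [quotMatrix, Matrix.of_apply, Matrix.map_apply, map_mul, map_sub, ← h]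

theorem IsDropData.map {a : R} {K : Finset J} {p : J → Fin m} (h : IsDropData a Z O K d p)
    (ρ : R →+* R') : IsDropData (ρ a) Z O K (fun i j => ρ (d i j)) p where
  disj := h.disj
  union := h.union
  eq_a j := by rw [h.eq_a]
  eq_one j i hi := by rw [h.eq_one j i hi, map_one]
  mono := h.mono

end map

/-! ### The free parameters and their number -/

section parameters

variable {R : Type*} [CommRing R] {J : Type*} [Fintype J] [DecidableEq J]
  {m N : ℕ} [NeZero m]

/-- The index set of the free parameters: the rows with index `k ∈ S`, at the place `p_k`, and the
columns with index `j ∈ T`, at the place `p_j + 1`. -/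
abbrev ParamIndex (O : Fin m → Finset J) (p : J → Fin m) (S T : Finset J) (N : ℕ) : Type _ :=
  (Σ k : {k // k ∈ S}, {j // j ∈ O (p k)}) ⊕ ({j // j ∈ T} × Fin N)

theorem card_paramIndex {O : Fin m → Finset J} {p : J → Fin m} {S T : Finset J} {N r : ℕ}
    (hO : ∀ i, (O i).card = r) : Fintype.card (ParamIndex O p S T N) = r * S.card + T.card * N := by
  simp [ParamIndex, hO, mul_comm]

/-- The free parameters of a family of graphs. -/
def params (O : Fin m → Finset J) (p : J → Fin m) (S T : Finset J) (f : Fin m → Fin N → J)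
    (A : Fin m → Matrix J J R) : ParamIndex O p S T N → R
  | Sum.inl q => A (p q.1) q.1 q.2
  | Sum.inr q => A (p q.1 + 1) (f (p q.1 + 1) q.2) q.1

theorem IsDropData.existsUnique_params {a : R} {Z O : Fin m → Finset J} {K : Finset J}
    {d : Fin m → J → R} {p : J → Fin m} (h : IsDropData a Z O K d p)
    {f : Fin m → Fin N → J} (hf : ∀ i, Function.Injective (f i))
    (hZ : ∀ i j, j ∈ Z i ↔ ∃ μ, f i μ = j) {S T : Finset J} (hS : Disjoint K S)
    (hT : ∀ j, j ∈ T ↔ j ∈ O (p j + 1))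
    {X : Fin m → Matrix (Fin N) (Fin N) R} (hX : IsCyclicTuple a Z d f X)
    (c : ParamIndex O p S T N → R) :
    ∃! A, IsGraphFamily (fun i => Z i ∪ S) O d A ∧ quotMatrix Z d f A = X ∧
      params O p S T f A = c := by
  let u : J → J → R := fun k j =>
    if hkj : k ∈ S ∧ j ∈ O (p k) then c (Sum.inl ⟨⟨k, hkj.1⟩, ⟨j, hkj.2⟩⟩) else 0
  let b : J → Fin N → R := fun j μ => if hj : j ∈ T then c (Sum.inr (⟨j, hj⟩, μ)) else 0
  have key : ∀ A : Fin m → Matrix J J R, params O p S T f A = c ↔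
      (∀ k ∈ S, ∀ j ∈ O (p k), A (p k) k j = u k j) ∧
        ∀ j, j ∈ O (p j + 1) → ∀ μ, A (p j + 1) (f (p j + 1) μ) j = b j μ := by
    intro A
    constructor
    · rintro rfl
      refine ⟨fun k hk j hj => ?_, fun j hj μ => ?_⟩
      · simp only [u, dif_pos (And.intro hk hj), params]
      · simp only [b, dif_pos ((hT j).2 hj), params]
    · rintro ⟨h1, h2⟩
      funext q
      rcases q with ⟨⟨k, hk⟩, ⟨j, hj⟩⟩ | ⟨⟨j, hj⟩, μ⟩
      · refine (h1 k hk j hj).trans ?_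
        simp only [u, dif_pos (And.intro hk hj)]
      · refine (h2 j ((hT j).1 hj) μ).trans ?_
        simp only [b, dif_pos hj]
  simp only [key]
  exact h.existsUnique_graph hf hZ hS hX u b

end parameters

/-! ### The equations of W evaluated at a point -/

section equations

variable {O : Type u} [CommRing O] {R : Type*} [CommRing R] {m n N : ℕ} [NeZero m]

theorem eval₂_equations_iff {φ : Fin m → Matrix (Fin n) (Fin n) O} {t : Fin m → Fin n → Fin 2}
    {jj : Fin m → Fin N → Fin n} {Z : Fin m → Finset (Fin n)} {π : O}
    (hZ : ∀ i i' ι, jj i ι ∈ Z i' ↔ t i' (jj i ι) = 0) (ρ : O →+* R)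
    (x : Fin m × Fin N × Fin N → R) :
    (∀ q ∈ columnEquations φ t jj ∪ productEquations π m N, MvPolynomial.eval₂ ρ x q = 0) ↔
      IsCyclicTuple (ρ π) Z (fun i j => ρ (φ i j j)) jj
        fun i => Matrix.of fun μ ν => x (i, μ, ν) := by
  have hprod : ∀ i μ ν, MvPolynomial.eval₂ ρ x (cyclicProd (genericMatrix O m N) i μ ν) =
      cyclicProd (fun i => Matrix.of fun μ ν => x (i, μ, ν)) i μ ν := by
    intro i μ ν
    have h1 := cyclicProd_map (m := m)
      (MvPolynomial.eval₂Hom ρ x).mapMatrix.toMonoidHom (genericMatrix O m N) i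
    have h2 : (fun k => (MvPolynomial.eval₂Hom ρ x).mapMatrix.toMonoidHom (genericMatrix O m N k)) =
        fun i => (Matrix.of fun μ ν => x (i, μ, ν) : Matrix (Fin N) (Fin N) R) := by
      funext k
      ext μ ν
      exact MvPolynomial.eval₂_X ρ x (k, μ, ν)
    rw [h2] at h1
    exact congrFun (congrFun h1 μ) ν
  constructor
  · intro H
    refine ⟨fun i μ ι hι => ?_, fun i => ?_⟩
    · have := H _ (Or.inl ⟨i, μ, ι, (hZ _ _ _).1 hι, rfl⟩)
      rw [MvPolynomial.eval₂_sub, MvPolynomial.eval₂_C, genericMatrix, Matrix.of_apply,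
        MvPolynomial.eval₂_X, sub_eq_zero] at this
      refine this.trans ?_
      split_ifs <;> simp
    · ext μ ν
      have := H _ (Or.inr ⟨i, μ, ν, rfl⟩)
      rw [MvPolynomial.eval₂_sub, MvPolynomial.eval₂_C, hprod, sub_eq_zero] at this
      rw [this, Matrix.smul_apply, Matrix.one_apply]
      split_ifs <;> simp
  · rintro ⟨H1, H2⟩ q (⟨i, μ, ι, hι, rfl⟩ | ⟨i, μ, ν, rfl⟩)
    · have : x (i, μ, ι) = if jj (i + 1) μ = jj i ι then ρ (φ i (jj i ι) (jj i ι)) else 0 :=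
        H1 i μ ι ((hZ _ _ _).2 hι)
      rw [MvPolynomial.eval₂_sub, MvPolynomial.eval₂_C, genericMatrix, Matrix.of_apply,
        MvPolynomial.eval₂_X, this]
      split_ifs <;> simp
    · rw [MvPolynomial.eval₂_sub, MvPolynomial.eval₂_C, hprod, H2, Matrix.smul_apply,
        Matrix.one_apply]
      split_ifs <;> simp

end equations

/-! ### From φ and t to the places p_j -/

section data

variable {O : Type u} [CommRing O] [IsDomain O] {π : O} {m n r : ℕ} [NeZero m]
  {φ : Fin m → Matrix (Fin n) (Fin n) O} {t : Fin m → Fin n → Fin 2}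

theorem IsGeneralizedLocalModel.eq_diagonal (hφ : IsGeneralizedLocalModel π φ) (i : Fin m) :
    φ i = Matrix.diagonal fun j => φ i j j := by
  obtain ⟨d, -, hd⟩ := hφ.1 i
  rw [hd]
  simp

/-- The j-th diagonal entries multiply to π. With no factor π the product would be 1; with two,
cancelling one would make π divide 1. Either way π would be a unit. -/
theorem IsGeneralizedLocalModel.exists_place (hφ : IsGeneralizedLocalModel π φ)
    (hπ : Irreducible π) (j : Fin n) : ∃ p, φ p j j = π ∧ ∀ i, i ≠ p → φ i j j = 1 := by
  have h1 : ∀ i, φ i j j = 1 ∨ φ i j j = π := by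
    intro i
    obtain ⟨d, hd, hφd⟩ := hφ.1 i
    rw [hφd, Matrix.diagonal_apply_eq]
    exact hd j
  have h2 : ∏ i, φ i j j = π := by
    have := hφ.2
    rw [funext hφ.eq_diagonal, cyclicProd_diagonal] at this
    simpa using congrFun (congrFun this j) j
  obtain ⟨p, hp⟩ : ∃ p, φ p j j = π := by
    by_contra! hcon
    rw [Finset.prod_eq_one fun i _ => (h1 i).resolve_right (hcon i)] at h2
    exact hπ.not_isUnit (h2 ▸ isUnit_one)
  refine ⟨p, hp, fun i hi => (h1 i).resolve_right fun hi' => hπ.not_isUnit ?_⟩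
  rw [← Finset.mul_prod_erase _ _ (Finset.mem_univ p), hp] at h2
  have h3 := mul_left_cancel₀ hπ.ne_zero (h2.trans (mul_one π).symm)
  rw [← hi']
  exact .of_mul_eq_one _ ((Finset.mul_prod_erase _ (fun i => φ i j j)
    (Finset.mem_erase.2 ⟨hi, Finset.mem_univ i⟩)).trans h3)

/-- The indices outside `constSet t 0` at which `t_i` is `0`. -/
def zeroSet (t : Fin m → Fin n → Fin 2) (i : Fin m) : Finset (Fin n) :=
  Finset.univ.filter fun j => t i j = 0 ∧ j ∉ constSet t 0

/-- The indices at which `t_i` is `1`. -/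
def oneSet (t : Fin m → Fin n → Fin 2) (i : Fin m) : Finset (Fin n) :=
  Finset.univ.filter fun j => t i j = 1

theorem mem_zeroSet {i : Fin m} {j : Fin n} :
    j ∈ zeroSet t i ↔ t i j = 0 ∧ j ∉ constSet t 0 := by simp [zeroSet]

theorem mem_oneSet {i : Fin m} {j : Fin n} : j ∈ oneSet t i ↔ t i j = 1 := by simp [oneSet]

theorem mem_constSet {a : Fin 2} {j : Fin n} : j ∈ constSet t a ↔ ∀ i, t i j = a := by
  simp [constSet]

theorem mem_zeroSet_union {i : Fin m} {j : Fin n} :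
    j ∈ zeroSet t i ∪ constSet t 0 ↔ t i j = 0 := by
  rw [Finset.mem_union, mem_zeroSet]
  have : j ∈ constSet t 0 → t i j = 0 := fun h => mem_constSet.1 h i
  tauto

theorem fin_two_eq_one_iff {a : Fin 2} : a = 1 ↔ a ≠ 0 := by
  fin_cases a <;> simp

theorem zeroSet_union_disjoint (i : Fin m) : Disjoint (zeroSet t i ∪ constSet t 0) (oneSet t i) :=
  Finset.disjoint_left.2 fun _ h1 h2 =>
    fin_two_eq_one_iff.1 (mem_oneSet.1 h2) (mem_zeroSet_union.1 h1)

theorem zeroSet_union_union (i : Fin m) :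
    (zeroSet t i ∪ constSet t 0) ∪ oneSet t i = Finset.univ := by
  ext j
  rw [Finset.mem_union, mem_zeroSet_union, mem_oneSet, fin_two_eq_one_iff]
  simp [em]

theorem isDropData (hφ : IsGeneralizedLocalModel π φ) (hπ : Irreducible π)
    (ht : IsAdmissible π r φ t) : ∃ p : Fin n → Fin m,
      IsDropData π (zeroSet t) (oneSet t) (constSet t 0)ᶜ (fun i j => φ i j j) p := by
  choose p hp hp' using hφ.exists_place hπ
  refine ⟨p, ?_, fun i => ?_, hp, hp', fun i j hj hi => ?_⟩
  · exact fun i => (zeroSet_union_disjoint i).mono_left Finset.subset_union_left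
  · ext j
    rw [Finset.mem_union, mem_zeroSet, mem_oneSet, Finset.mem_compl, fin_two_eq_one_iff]
    have : j ∈ constSet t 0 → t i j = 0 := fun h => mem_constSet.1 h i
    tauto
  · rw [mem_oneSet] at hj ⊢
    rw [fin_two_eq_one_iff]
    intro h0
    -- A drop at i ≠ p_j would force the entry 1 of φ_i to equal π.
    have h1 := congrFun (ht.drop i j hj h0) j
    rw [Matrix.mulVec_single_one, Matrix.col_apply, hp' j i hi] at h1
    simp only [Pi.smul_apply, Pi.single_eq_same, smul_eq_mul, mul_one] at h1
    exact hπ.not_isUnit (h1 ▸ isUnit_one)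

end data

/-! ### The isomorphism of functors -/

section representability

variable {O : Type u} [CommRing O] {m n r N : ℕ} [NeZero m]
  {φ : Fin m → Matrix (Fin n) (Fin n) O} {t : Fin m → Fin n → Fin 2}

/-- The family `A` of matrices of global functions has graphs which form a point of the chart. -/
abbrev IsChartFamily (φ : Fin m → Matrix (Fin n) (Fin n) O) (t : Fin m → Fin n → Fin 2)
    (X : Over (Spec (.of O))) (A : Fin m → Matrix (Fin n) (Fin n) Γ(X.left, ⊤)) : Prop :=
  IsGraphFamily (fun i => zeroSet t i ∪ constSet t 0) (oneSet t)
    (fun i j => scal X ⊤ (φ i j j)) A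

theorem pull_scal_entries {X Y : Over (Spec (.of O))} (g : X ⟶ Y) :
    (fun i j => pull g.left (le_top : ⊤ ≤ g.left ⁻¹ᵁ ⊤) (scal Y ⊤ (φ i j j))) =
      fun i j => scal X ⊤ (φ i j j) :=
  funext₂ fun _ _ => pull_scal g le_top _

theorem IsChartFamily.map {X Y : Over (Spec (.of O))} (g : X ⟶ Y)
    {A : Fin m → Matrix (Fin n) (Fin n) Γ(Y.left, ⊤)} (hA : IsChartFamily φ t Y A) :
    IsChartFamily φ t X fun i => (A i).map (pull g.left (le_top : ⊤ ≤ g.left ⁻¹ᵁ ⊤)) := by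
  have := IsGraphFamily.map hA (pull g.left (le_top : ⊤ ≤ g.left ⁻¹ᵁ ⊤))
  rwa [pull_scal_entries] at this

theorem mapsInto_iff_isChartFamily (hφ : ∀ i, φ i = Matrix.diagonal fun j => φ i j j)
    {X : Over (Spec (.of O))} {A : Fin m → Matrix (Fin n) (Fin n) Γ(X.left, ⊤)}
    (hA : ∀ i, IsSupported (zeroSet t i ∪ constSet t 0) (oneSet t i) (A i)) :
    (∀ i, MapsInto X (φ i) (graphSub (zeroSet t i ∪ constSet t 0) (A i))
      (graphSub (zeroSet t (i + 1) ∪ constSet t 0) (A (i + 1)))) ↔ IsChartFamily φ t X A := by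
  rw [IsChartFamily, IsGraphFamily, and_iff_right hA]
  refine forall_congr' fun i => ?_
  rw [mapsInto_graphSub_iff (zeroSet_union_union i) (zeroSet_union_disjoint i) (hA i)]
  have : (φ i).map (scal X ⊤) = Matrix.diagonal fun j => scal X ⊤ (φ i j j) := by
    conv_lhs => rw [hφ i]
    exact diagonal_map_ringHom _ _
  rw [this]

theorem setOf_mem_zeroSet_union (i : Fin m) :
    {j | j ∈ zeroSet t i ∪ constSet t 0} = {j | t i j = 0} :=
  Set.ext fun _ => mem_zeroSet_union

/-- The points of the chart are the families of graphs. -/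
theorem exists_isChartFamily (hφ : ∀ i, φ i = Matrix.diagonal fun j => φ i j j)
    (hr : ∀ i, (oneSet t i).card = r) {X : (Over (Spec (.of O)))ᵒᵖ}
    (F : (chart n r φ t).toFunctor.obj X) :
    ∃ A, IsChartFamily φ t X.unop A ∧
      ∀ i, F.1.1 i = graphSub (zeroSet t i ∪ constSet t 0) (A i) := by
  have h := fun i => exists_eq_graphSub (zeroSet_union_union i) (zeroSet_union_disjoint i) (hr i)
    (F.1.2.1 i) (by rw [setOf_mem_zeroSet_union]; exact F.2 i)
  choose A hA hFA using h
  refine ⟨A, (mapsInto_iff_isChartFamily hφ hA).1 fun i => ?_, hFA⟩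
  rw [← hFA, ← hFA]
  exact F.1.2.2 i

theorem exists_chart_point (hφ : ∀ i, φ i = Matrix.diagonal fun j => φ i j j)
    (hr : ∀ i, (oneSet t i).card = r) {X : (Over (Spec (.of O)))ᵒᵖ}
    {A : Fin m → Matrix (Fin n) (Fin n) Γ(X.unop.left, ⊤)} (hA : IsChartFamily φ t X.unop A) :
    ∃ F : (chart n r φ t).toFunctor.obj X,
      ∀ i, F.1.1 i = graphSub (zeroSet t i ∪ constSet t 0) (A i) := by
  refine ⟨⟨⟨fun i => graphSub (zeroSet t i ∪ constSet t 0) (A i), fun i => ?_,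
    (mapsInto_iff_isChartFamily hφ hA.1).2 hA⟩, fun i => ?_⟩, fun i => rfl⟩
  · exact graphSub_isLocallyFree (zeroSet_union_union i) (zeroSet_union_disjoint i) (hr i) (hA.1 i)
  · have := graphSub_quotientGeneratedBy (zeroSet_union_union i) (zeroSet_union_disjoint i) (hA.1 i)
    rwa [setOf_mem_zeroSet_union] at this

variable {π : O} {p : Fin n → Fin m} {f : Fin m → Fin N → Fin n} {d : ℕ}

/-- The matrix entries of a point of `W`. -/
noncomputable def entries {X : Over (Spec (.of O))} (g : X ⟶ schemeW π φ t f)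
    (q : Fin m × Fin N × Fin N) : Γ(X.left, ⊤) :=
  zeroCoord (E := columnEquations φ t f ∪ productEquations π m N) g q

theorem entries_comp {X Y : Over (Spec (.of O))} (k : X ⟶ Y) (g : Y ⟶ schemeW π φ t f)
    (q : Fin m × Fin N × Fin N) :
    entries (k ≫ g) q = pull k.left (le_top : ⊤ ≤ k.left ⁻¹ᵁ ⊤) (entries g q) :=
  zeroCoord_comp (E := columnEquations φ t f ∪ productEquations π m N) k g q

theorem entries_injective {X : Over (Spec (.of O))} :
    Function.Injective (entries : (X ⟶ schemeW π φ t f) → _) :=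
  zeroCoord_injective (E := columnEquations φ t f ∪ productEquations π m N)

theorem isCyclicTuple_entries {Z : Fin m → Finset (Fin n)}
    (hZ : ∀ i i' ι, f i ι ∈ Z i' ↔ t i' (f i ι) = 0) {X : Over (Spec (.of O))}
    (g : X ⟶ schemeW π φ t f) :
    IsCyclicTuple (scal X ⊤ π) Z (fun i j => scal X ⊤ (φ i j j)) f
      fun i => Matrix.of fun μ ν => entries g (i, μ, ν) :=
  (eval₂_equations_iff hZ (scal X ⊤) (entries g)).1 fun _ hq => eval₂_zeroCoord g hq

theorem exists_entries_eq {Z : Fin m → Finset (Fin n)}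
    (hZ : ∀ i i' ι, f i ι ∈ Z i' ↔ t i' (f i ι) = 0) {X : Over (Spec (.of O))}
    {A : Fin m → Matrix (Fin N) (Fin N) Γ(X.left, ⊤)}
    (hA : IsCyclicTuple (scal X ⊤ π) Z (fun i j => scal X ⊤ (φ i j j)) f A) :
    ∃ g : X ⟶ schemeW π φ t f, ∀ q, entries g q = A q.1 q.2.1 q.2.2 := by
  obtain ⟨g, hg⟩ := exists_zeroCoord_eq (E := columnEquations φ t f ∪ productEquations π m N)
    (fun q => A q.1 q.2.1 q.2.2) ((eval₂_equations_iff hZ (scal X ⊤) _).2 hA)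
  exact ⟨g, congrFun hg⟩

/-- The point `g` of `W × 𝔸 ^ d` has the coordinates that belong to the family `A` of graphs. -/
def HasCoords (π : O) (φ : Fin m → Matrix (Fin n) (Fin n) O) (t : Fin m → Fin n → Fin 2)
    (p : Fin n → Fin m) (f : Fin m → Fin N → Fin n)
    (ε : Fin d ≃ ParamIndex (oneSet t) p (constSet t 0) (constSet t 1) N)
    {X : Over (Spec (.of O))} (A : Fin m → Matrix (Fin n) (Fin n) Γ(X.left, ⊤))
    (g : X ⟶ timesAffineSpace (schemeW π φ t f) d) : Prop :=
  (∀ i μ ν, entries (affineBase g) (i, μ, ν) =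
      quotMatrix (zeroSet t) (fun i j => scal X ⊤ (φ i j j)) f A i μ ν) ∧
    ∀ k, affineCoord g k = params (oneSet t) p (constSet t 0) (constSet t 1) f A (ε k)

variable {ε : Fin d ≃ ParamIndex (oneSet t) p (constSet t 0) (constSet t 1) N}

theorem HasCoords.comp {X Y : Over (Spec (.of O))}
    {A : Fin m → Matrix (Fin n) (Fin n) Γ(Y.left, ⊤)}
    {g : Y ⟶ timesAffineSpace (schemeW π φ t f) d} (h : HasCoords π φ t p f ε A g) (k : X ⟶ Y) :
    HasCoords π φ t p f ε
      (fun i => (A i).map (pull k.left (le_top : ⊤ ≤ k.left ⁻¹ᵁ ⊤))) (k ≫ g) := by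
  refine ⟨fun i μ ν => ?_, fun l => ?_⟩
  · rw [affineBase_comp, entries_comp, h.1, ← quotMatrix_map, pull_scal_entries]
  · rw [affineCoord_comp, h.2]
    rcases ε l with q | q <;> rfl

theorem mem_constSet_one_iff {a : O} {Z : Fin m → Finset (Fin n)} {K : Finset (Fin n)}
    {D : Fin m → Fin n → O} (h : IsDropData a Z (oneSet t) K D p) (j : Fin n) :
    j ∈ constSet t 1 ↔ j ∈ oneSet t (p j + 1) := by
  constructor
  · exact fun hj => mem_oneSet.2 (mem_constSet.1 hj _)
  · exact fun hj => mem_constSet.2 fun i => mem_oneSet.1 (h.mem_O_of_mem hj i)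

/-- Existence amounts to the quotient matrices of A satisfying the equations of W, which only
involve the family with the rows in S removed. Uniqueness holds because a point of W × 𝔸^d is
determined by its coordinates. -/
theorem existsUnique_hasCoords
    (h : IsDropData π (zeroSet t) (oneSet t) (constSet t 0)ᶜ (fun i j => φ i j j) p)
    (hf : ∀ i, Function.Injective (f i)) (hZ : ∀ i j, j ∈ zeroSet t i ↔ ∃ μ, f i μ = j)
    {X : Over (Spec (.of O))} {A : Fin m → Matrix (Fin n) (Fin n) Γ(X.left, ⊤)}
    (hA : IsChartFamily φ t X A) : ∃! g, HasCoords π φ t p f ε A g := by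
  have h' := h.map (scal X ⊤)
  have hA' := ((isGraphFamily_union_iff h'.disj h'.union disjoint_compl_left hA.1).1 hA).1
  have hX := h'.isCyclicTuple_quotMatrix hf hZ hA' fun i z j hzj =>
    (isSupported_iff.1 (hA.1 i) z j hzj).2
  have hZf : ∀ i i' ι, f i ι ∈ zeroSet t i' ↔ t i' (f i ι) = 0 := fun i i' ι => by
    rw [mem_zeroSet, and_iff_left]
    exact (mem_zeroSet.1 ((hZ i _).2 ⟨ι, rfl⟩)).2
  obtain ⟨g₁, hg₁⟩ := exists_entries_eq hZf hX
  obtain ⟨g, hg, hg'⟩ := exists_timesAffineSpace_hom (Z := schemeW π φ t f) (d := d) g₁ fun k =>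
    params (oneSet t) p (constSet t 0) (constSet t 1) f A (ε k)
  refine ⟨g, ⟨fun i μ ν => ?_, fun k => congrFun hg' k⟩, fun g' hg'' => ?_⟩
  · rw [hg]
    exact hg₁ (i, μ, ν)
  · refine timesAffineSpace_hom_ext ?_ ?_
    · refine entries_injective (funext fun q => ?_)
      rw [hg, hg₁]
      exact hg''.1 q.1 q.2.1 q.2.2
    · rw [hg']
      exact funext hg''.2

theorem existsUnique_isChartFamily
    (h : IsDropData π (zeroSet t) (oneSet t) (constSet t 0)ᶜ (fun i j => φ i j j) p)
    (hf : ∀ i, Function.Injective (f i)) (hZ : ∀ i j, j ∈ zeroSet t i ↔ ∃ μ, f i μ = j)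
    {X : Over (Spec (.of O))} (g : X ⟶ timesAffineSpace (schemeW π φ t f) d) :
    ∃! A, IsChartFamily φ t X A ∧ HasCoords π φ t p f ε A g := by
  have h' := h.map (scal X ⊤)
  have hZf : ∀ i i' ι, f i ι ∈ zeroSet t i' ↔ t i' (f i ι) = 0 := fun i i' ι => by
    rw [mem_zeroSet, and_iff_left]
    exact (mem_zeroSet.1 ((hZ i _).2 ⟨ι, rfl⟩)).2
  have hX := isCyclicTuple_entries hZf (affineBase g)
  have key := h'.existsUnique_params hf hZ (S := constSet t 0) disjoint_compl_left
    (mem_constSet_one_iff h) hX fun q => affineCoord g (ε.symm q)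
  refine (existsUnique_congr fun A => and_congr_right fun _ => ?_).1 key
  refine and_congr ⟨fun hA i μ ν => ?_, fun hA => ?_⟩ ⟨fun hA k => ?_, fun hA => ?_⟩
  · rw [hA]
    rfl
  · funext i
    ext μ ν
    exact (hA i μ ν).symm
  · rw [hA]
    beta_reduce
    rw [Equiv.symm_apply_apply]
  · funext q
    rw [hA, Equiv.apply_symm_apply]

theorem chart_iso (hφ : ∀ i, φ i = Matrix.diagonal fun j => φ i j j)
    (hr : ∀ i, (oneSet t i).card = r)
    (h : IsDropData π (zeroSet t) (oneSet t) (constSet t 0)ᶜ (fun i j => φ i j j) p)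
    (hf : ∀ i, Function.Injective (f i)) (hZ : ∀ i j, j ∈ zeroSet t i ↔ ∃ μ, f i μ = j)
    (ε : Fin d ≃ ParamIndex (oneSet t) p (constSet t 0) (constSet t 1) N) :
    Nonempty ((chart n r φ t).toFunctor ≅
      yoneda.obj (timesAffineSpace (schemeW π φ t f) d)) := by
  refine nonempty_iso_of_rel (fun X F g => ∃ A, IsChartFamily φ t X.unop A ∧
    (∀ i, F.1.1 i = graphSub (zeroSet t i ∪ constSet t 0) (A i)) ∧ HasCoords π φ t p f ε A g)
    (fun X F => ?_) (fun X g => ?_) fun {X Y} k F g => ?_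
  · obtain ⟨A, hA, hFA⟩ := exists_isChartFamily hφ hr F
    obtain ⟨g, hg, hg'⟩ := existsUnique_hasCoords (ε := ε) h hf hZ hA
    refine ⟨g, ⟨A, hA, hFA, hg⟩, fun g' ⟨A', hA', hFA', hgA'⟩ => hg' g' ?_⟩
    -- The point F of the chart determines its matrices, so any related g has the coordinates of the
    -- same A.
    have : A' = A := funext fun i => IsGraphOn.unique (zeroSet_union_disjoint i) (hA'.1 i) (hA.1 i)
      (isGraphOn_graphSub _) (((hFA' i).symm.trans (hFA i)) ▸ isGraphOn_graphSub _)
    rwa [← this]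
  · obtain ⟨A, ⟨hA, hgA⟩, hA'⟩ := existsUnique_isChartFamily (ε := ε) h hf hZ g
    obtain ⟨F, hF⟩ := exists_chart_point hφ hr hA
    refine ⟨F, ⟨A, hA, hF, hgA⟩, fun F' ⟨B, hB, hFB, hgB⟩ => ?_⟩
    have : B = A := hA' B ⟨hB, hgB⟩
    refine Subtype.ext (Subtype.ext (funext fun i => ?_))
    rw [hFB, hF, this]
  · rintro ⟨A, hA, hFA, hgA⟩
    refine ⟨_, hA.map k.unop, fun i => ?_, hgA.comp k.unop⟩
    rw [← graphSub_pullback k.unop.left (zeroSet_union_union i) (zeroSet_union_disjoint i) (hA.1 i),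
      ← hFA]
    rfl

end representability

end LocalModel

theorem mainTheorem9 {O : Type u} [CommRing O] [IsDomain O] [IsDiscreteValuationRing O]
    (π : O) (hπ : Irreducible π) (m n r : ℕ) [NeZero m]
    (φ : Fin m → Matrix (Fin n) (Fin n) O) (hφ : LocalModel.IsGeneralizedLocalModel π φ)
    (t : Fin m → Fin n → Fin 2) (ht : LocalModel.IsAdmissible π r φ t)
    (s τ : ℕ) (hs : s = (LocalModel.constSet t 0).card) (hτ : τ = (LocalModel.constSet t 1).card)
    (e : ∀ i : Fin m, Fin (n - r - s) ≃ {j : Fin n // t i j = 0 ∧ j ∉ LocalModel.constSet t 0}) :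
    Nonempty ((LocalModel.chart n r φ t).toFunctor ≅
      yoneda.obj (LocalModel.timesAffineSpace
        (LocalModel.schemeW π φ t fun i ι => (e i ι : Fin n))
        (r * s + τ * (n - r - s)))) := by
  obtain ⟨p, h⟩ := LocalModel.isDropData hφ hπ ht
  refine LocalModel.chart_iso hφ.eq_diagonal ht.card_eq h
    (fun i => Subtype.val_injective.comp (e i).injective) (fun i j => ?_)
    (Fintype.equivFinOfCardEq ?_).symm
  · rw [LocalModel.mem_zeroSet]
    exact ⟨fun hj => ⟨(e i).symm ⟨j, hj⟩, by simp⟩, by rintro ⟨μ, rfl⟩; exact (e i μ).2⟩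
  -- Each k ∈ S contributes the r entries of its row at p_k, since every O_i has r elements; each j
  -- ∈ T contributes the N entries of its column at p_j + 1.
  · rw [LocalModel.card_paramIndex (O := LocalModel.oneSet t) ht.card_eq, hs, hτ]
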